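/- Let $f\in\mathbb{R}[x_1,\dots,x_n]$ and $k\in\mathbb{N}$. Write $f=\sum_{\alpha} a_\alpha\, x_1^{\alpha_1}\cdots x_n^{\alpha_n}/(\alpha_1!\cdots\alpha_n!)$ (the scaled monomial basis) and let $\mathcal M$ be the set of exponents $\alpha$ with $a_\alpha\ne 0$. Let $M$ be the real matrix whose rows are indexed by the $k$-element subsets $I$ of $\{1,\dots,n\}$ and whose row $I$ lists the coordinates, in the scaled monomial basis, of the partial derivative $\partial_I f$ (one differentiation with respect to each $x_i$, $i\in I$); only finitely many columns can be nonzero and $M$ is restricted to a finite set of columns containing them. Let $B=M^TM$, and define the proxy rank $\mathrm{Tr}(B)^2/\mathrm{Tr}(B^2)$, with value $0$ if $B=0$. Let $\partial^{=k}f$ be the linear span of all partial derivatives of $f$ of order $k$. Identify subsets of $\{1,\dots,n\}$ with $0/1$ vectors, and for $P,Q,R\in\mathcal M$ let $N(P,Q,R)$ be $0$ if $Q+R-P\notin\mathcal M$, and otherwise the number of $k$-element sets $I$ with $I\le P$, $I\le Q$ (coordinatewise) and $P-I=R-J$ for some $k$-element set $J$. Then: 1. $\mathrm{Tr}(B)^2/\mathrm{Tr}(B^2)\le\dim\partial^{=k}f$.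 2. $\mathrm{Tr}(B^2)=\sum_{P,Q,R\in\mathcal M}N(P,Q,R)\,a_P\,a_Q\,a_R\,a_{Q+R-P}$ (terms with $Q+R-P\notin\mathcal M$ are $0$). 3. $N(P,Q,R)=\binom{\mathrm{zeros}}{k-\mathrm{ones}}$ if $Q+R-P\in\mathcal M$, $P-R\in\{-1,0,1\}^n$ has as many entries $1$ as $-1$, and $\min(P,Q)$ is positive at all entries $1$ of $P-R$; otherwise $N(P,Q,R)=0$. Here $\mathrm{ones}$ is the number of entries $1$ of $P-R$, $\mathrm{zeros}$ is the number of positions at which $P-R$ is $0$ and the coordinatewise minimum $\min(P,Q)$ is positive, and the binomial coefficient is $0$ if $k<\mathrm{ones}$. 4. There is a Turing machine which, given $k$ (in binary) and a polynomial $f$ with rational coefficients in sparse representation, computes $\mathrm{Tr}(B)^2/\mathrm{Tr}(B^2)$, as a fraction of integers written in binary, in time polynomial in the length of the input. The sparse representation consists of $n$ (in unary) and the list of the nonzero monomials of $f$, each given by its $n$ exponents and its coefficient, a fraction of integers in binary. This holds both (a) if the coefficients given are the coordinates $a_\alpha$ of $f$ in the scaled monomial basis and the exponents are written in binary, and (b)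 if the coefficients given are those of the usual monomials $x_1^{\alpha_1}\cdots x_n^{\alpha_n}$ and the exponents are written in unary. -/

import Mathlib

open scoped BigOperators Nat

noncomputable section

namespace ProxyRank

/-! ### Partial derivatives and the matrix of partial derivatives -/

/-- The partial derivative `∂_β f`: for every `i`, differentiate `β i` times with respect to the
`i`-th variable. -/
def partialDeriv {n : ℕ} (β : Fin n → ℕ) (f : MvPolynomial (Fin n) ℝ) : MvPolynomial (Fin n) ℝ :=
  (List.finRange n).foldr (fun i g => (MvPolynomial.pderiv i)^[β i] g) f

/-- The linear space `∂^{=k} f` spanned by the partial derivatives of `f` of order `k`. -/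
def derivSpace {n : ℕ} (f : MvPolynomial (Fin n) ℝ) (k : ℕ) :
    Submodule ℝ (MvPolynomial (Fin n) ℝ) :=
  Submodule.span ℝ {g | ∃ β : Fin n → ℕ, ∑ i, β i = k ∧ g = partialDeriv β f}

/-- The coordinate `a_α` of `f` in the scaled monomial basis: `f = ∑ a_α x^α / (α₁! ⋯ αₙ!)`. -/
def scaledCoeff {n : ℕ} (f : MvPolynomial (Fin n) ℝ) (α : Fin n →₀ ℕ) : ℝ :=
  f.coeff α * ∏ i, ((α i)! : ℝ)

/-- The 0/1 vector of a set of variables. -/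
def ind {n : ℕ} (I : Finset (Fin n)) (i : Fin n) : ℕ := if i ∈ I then 1 else 0

/-- The matrix `M`. The rows are indexed by the subsets `I` of the variables of size `k`, and row
`I` holds the coordinates of `∂_I f` in the scaled monomial basis. The columns are indexed by the
exponent vectors with entries at most `deg f`; all other columns would be zero. -/
def derivMatrix {n : ℕ} (f : MvPolynomial (Fin n) ℝ) (k : ℕ) :
    Matrix {I : Finset (Fin n) // I.card = k} (Fin n → Fin (f.totalDegree + 1)) ℝ :=
  Matrix.of fun I J =>
    scaledCoeff (partialDeriv (ind I.1) f) (Finsupp.equivFunOnFinite.symm fun i => (J i : ℕ))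

/-- The symmetric matrix `B = Mᵀ M`. -/
def gram {n : ℕ} (f : MvPolynomial (Fin n) ℝ) (k : ℕ) :
    Matrix (Fin n → Fin (f.totalDegree + 1)) (Fin n → Fin (f.totalDegree + 1)) ℝ :=
  (derivMatrix f k).transpose * derivMatrix f k

/-- The proxy rank `Tr(B)² / Tr(B²)`. It is `0` when `B = 0`. -/
def proxyRank {n : ℕ} (f : MvPolynomial (Fin n) ℝ) (k : ℕ) : ℝ :=
  (gram f k).trace ^ 2 / (gram f k * gram f k).trace

/-! ### The numbers `N(P,Q,R)` -/

/-- The set of the row indices `I` such that `(P,Q,R,I)` is a quadruple of `𝒰`: the four tuples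
`P`, `Q`, `R`, `Q+R-P` are exponents of monomials of `f`, the set `I` has size `k`, `I ≤ P`,
`I ≤ Q`, and `P - I = R - J` for some row index `J`. -/
def rowSet {n : ℕ} (f : MvPolynomial (Fin n) ℝ) (k : ℕ) (P Q R : Fin n →₀ ℕ) :
    Set (Finset (Fin n)) :=
  {I | (P ∈ f.support ∧ Q ∈ f.support ∧ R ∈ f.support ∧ P ≤ Q + R ∧ Q + R - P ∈ f.support) ∧
    I.card = k ∧ (∀ i, ind I i ≤ P i) ∧ (∀ i, ind I i ≤ Q i) ∧
    ∃ J : Finset (Fin n), J.card = k ∧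
      ∀ i, (P i : ℤ) - (ind I i : ℤ) = (R i : ℤ) - (ind J i : ℤ)}

/-- `N(P,Q,R)`, the number of row indices `I` such that `(P,Q,R,I)` is in `𝒰`. -/
def rowCount {n : ℕ} (f : MvPolynomial (Fin n) ℝ) (k : ℕ) (P Q R : Fin n →₀ ℕ) : ℕ :=
  (rowSet f k P Q R).ncard

/-- The positions of the entries `1` of `P - R`. -/
def onesSet {n : ℕ} (P R : Fin n →₀ ℕ) : Finset (Fin n) :=
  Finset.univ.filter fun i => P i = R i + 1

/-- The positions of the entries `0` of `P - R` at which `min(P,Q)` is positive. -/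
def zerosSet {n : ℕ} (P Q R : Fin n →₀ ℕ) : Finset (Fin n) :=
  Finset.univ.filter fun i => P i = R i ∧ 0 < min (P i) (Q i)

open scoped Classical in
/-- The closed form of `N(P,Q,R)`: it is `0` unless `Q+R-P` is the exponent of a monomial of `f`,
`P-R` has all its entries in `{-1,0,1}`, it has as many entries `1` as `-1`, and `min(P,Q)` is
positive at all its entries `1`; in that case it is the binomial coefficient of
`zeros(P,Q,R)` over `k - ones(P,R)`, which is `0` if `k < ones(P,R)`. -/
def binomCount {n : ℕ} (f : MvPolynomial (Fin n) ℝ) (k : ℕ) (P Q R : Fin n →₀ ℕ) : ℕ :=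
  if (P ≤ Q + R ∧ Q + R - P ∈ f.support) ∧
      (∀ i, P i ≤ R i + 1 ∧ R i ≤ P i + 1) ∧
      (onesSet P R).card = (onesSet R P).card ∧
      (∀ i ∈ onesSet P R, 0 < min (P i) (Q i)) ∧
      (onesSet P R).card ≤ k
  then (zerosSet P Q R).card.choose (k - (onesSet P R).card)
  else 0

/-! ### Inputs and outputs of the algorithm -/

/-- A fraction: numerator and positive denominator, not necessarily coprime. -/
abbrev Frac := ℤ × ℕ+

/-- The number denoted by a fraction. -/
def fracVal (q : Frac) : ℝ := (q.1 : ℝ) / ((q.2 : ℕ) : ℝ)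

/-- The sparse representation of a polynomial in `n` variables with rational coefficients: the list
of its monomials (exponent vector and coefficient), without repetition, with nonzero coefficients. -/
structure SparsePoly (n : ℕ) where
  terms : List ((Fin n →₀ ℕ) × Frac)
  nodup : (terms.map Prod.fst).Nodup
  ne_zero : ∀ t ∈ terms, t.2.1 ≠ 0

/-- The polynomial `∑ c_α x^α / (α₁! ⋯ αₙ!)`: the listed coefficients are the coordinates in the
scaled monomial basis. -/
def SparsePoly.scaledPoly {n : ℕ} (s : SparsePoly n) : MvPolynomial (Fin n) ℝ :=
  (s.terms.map fun t => MvPolynomial.monomial t.1 (fracVal t.2 / ∏ i, ((t.1 i)! : ℝ))).sum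

/-- The polynomial `∑ c_α x^α`: the listed coefficients are the coordinates in the usual monomial
basis. -/
def SparsePoly.usualPoly {n : ℕ} (s : SparsePoly n) : MvPolynomial (Fin n) ℝ :=
  (s.terms.map fun t => MvPolynomial.monomial t.1 (fracVal t.2)).sum

/-- An input: a number of variables, a sparse polynomial in these variables, and an order `k`. -/
structure Input where
  n : ℕ
  k : ℕ
  poly : SparsePoly n

/-! ### Encodings as words over a finite alphabet -/

/-- The alphabet: two bits, brackets, a comma (and a blank). -/
abbrev Sym := Computability.Γ'

/-- A natural number in binary (least significant bit first), ended by a comma. -/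
def encBin (m : ℕ) : List Sym :=
  (Computability.encodeNat m).map Computability.Γ'.bit ++ [Computability.Γ'.comma]

/-- A natural number in unary, ended by a comma. -/
def encUn (m : ℕ) : List Sym :=
  List.replicate m (Computability.Γ'.bit true) ++ [Computability.Γ'.comma]

/-- A fraction: a sign bit, the absolute value of the numerator and the denominator, in binary. -/
def encFrac (q : Frac) : List Sym :=
  Computability.Γ'.bit (decide (q.1 < 0)) :: (encBin q.1.natAbs ++ encBin (q.2 : ℕ))

/-- A monomial in brackets: its coefficient, then its `n` exponents, each written with `e`. -/
def encTerm (e : ℕ → List Sym) {n : ℕ} (t : (Fin n →₀ ℕ) × Frac) : List Sym :=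
  Computability.Γ'.bra ::
    (encFrac t.2 ++ ((List.ofFn fun i => t.1 i).flatMap e ++ [Computability.Γ'.ket]))

/-- An input: `n` in unary, `k` in binary, then the monomials, with exponents written with `e`. -/
def encInput (e : ℕ → List Sym) (x : Input) : List Sym :=
  encUn x.n ++ (encBin x.k ++ x.poly.terms.flatMap (encTerm e))

/-- Words of the code can be read off from the front of a longer word. -/
def PrefixFree {α : Type} (e : α → List Sym) : Prop :=
  ∀ x y l l', e x ++ l = e y ++ l' → x = y ∧ l = l'

theorem prefix_bits (u v : List Bool) (l l' : List Sym)
    (h : u.map Computability.Γ'.bit ++ Computability.Γ'.comma :: l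
      = v.map Computability.Γ'.bit ++ Computability.Γ'.comma :: l') : u = v ∧ l = l' := by
  induction u generalizing v with
  | nil => cases v <;> simp_all
  | cons a u ih =>
    cases v with
    | nil => simp at h
    | cons b v =>
      simp only [List.map_cons, List.cons_append, List.cons.injEq,
        Computability.Γ'.bit.injEq] at h
      obtain ⟨h1, h2⟩ := ih v h.2
      simp [h.1, h1, h2]

theorem prefixFree_encBin : PrefixFree encBin := by
  intro x y l l' h
  simp only [encBin, List.append_assoc, List.singleton_append] at h
  obtain ⟨h1, h2⟩ := prefix_bits _ _ _ _ h
  refine ⟨?_, h2⟩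
  rw [← Computability.decode_encodeNat x, h1, Computability.decode_encodeNat]

theorem prefixFree_encUn : PrefixFree encUn := by
  intro x y l l' h
  simp only [encUn, List.append_assoc, List.singleton_append, ← List.map_replicate] at h
  obtain ⟨h1, h2⟩ := prefix_bits _ _ _ _ h
  exact ⟨by simpa using congrArg List.length h1, h2⟩

theorem prefixFree_encFrac : PrefixFree encFrac := by
  rintro ⟨a, b⟩ ⟨c, d⟩ l l' h
  simp only [encFrac, List.cons_append, List.append_assoc, List.cons.injEq,
    Computability.Γ'.bit.injEq, decide_eq_decide] at h
  obtain ⟨h0, h⟩ := h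
  obtain ⟨h1, h⟩ := prefixFree_encBin _ _ _ _ h
  obtain ⟨h2, h⟩ := prefixFree_encBin _ _ _ _ h
  refine ⟨Prod.ext ?_ (PNat.coe_injective h2), h⟩
  show a = c
  omega

theorem prefixFree_flatMap {α : Type} {e : α → List Sym} (he : PrefixFree e) (u v : List α)
    (huv : u.length = v.length) (l l' : List Sym)
    (h : u.flatMap e ++ l = v.flatMap e ++ l') : u = v ∧ l = l' := by
  induction u generalizing v with
  | nil => cases v <;> simp_all
  | cons a u ih =>
    cases v with
    | nil => simp at huv
    | cons b v =>
      simp only [List.flatMap_cons, List.append_assoc] at h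
      obtain ⟨h1, h⟩ := he _ _ _ _ h
      obtain ⟨h2, h⟩ := ih v (by simpa using huv) h
      exact ⟨by rw [h1, h2], h⟩

theorem prefixFree_encTerm {e : ℕ → List Sym} (he : PrefixFree e) (n : ℕ) :
    PrefixFree (encTerm e (n := n)) := by
  rintro ⟨a, b⟩ ⟨c, d⟩ l l' h
  simp only [encTerm, List.cons_append, List.append_assoc, List.cons.injEq, true_and] at h
  obtain ⟨h1, h⟩ := prefixFree_encFrac _ _ _ _ h
  obtain ⟨h2, h⟩ := prefixFree_flatMap he _ _ (by simp) _ _ h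
  refine ⟨Prod.ext (DFunLike.coe_injective (List.ofFn_injective h2)) h1, by simpa using h⟩

theorem encTerms_injective {e : ℕ → List Sym} (he : PrefixFree e) (n : ℕ)
    (u v : List ((Fin n →₀ ℕ) × Frac)) (h : u.flatMap (encTerm e) = v.flatMap (encTerm e)) :
    u = v := by
  induction u generalizing v with
  | nil => cases v <;> simp_all [encTerm]
  | cons a u ih =>
    cases v with
    | nil => simp [encTerm] at h
    | cons b v =>
      simp only [List.flatMap_cons] at h
      obtain ⟨h1, h⟩ := prefixFree_encTerm he n _ _ _ _ h
      rw [h1, ih v h]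

/-- The encoding of the fractions is injective. -/
theorem encFrac_injective : Function.Injective encFrac := fun x y h =>
  (prefixFree_encFrac x y [] [] (by rw [h])).1

/-- The encodings of the inputs are injective. -/
theorem encInput_injective {e : ℕ → List Sym} (he : PrefixFree e) :
    Function.Injective (encInput e) := by
  rintro ⟨n, k, s⟩ ⟨n', k', s'⟩ h
  simp only [encInput] at h
  obtain ⟨h1, h⟩ := prefixFree_encUn _ _ _ _ h
  subst h1
  obtain ⟨h2, h4⟩ := prefixFree_encBin _ _ _ _ h
  subst h2
  have h3 := encTerms_injective he n _ _ h4
  cases s; cases s'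
  simp only at h3
  subst h3
  rfl

/-- The function `g` is computed by a Turing machine (with finitely many stacks) in a number of
steps bounded by a polynomial in the length of the input word. -/
def PolyTime {α β : Type} (ea : α → List Sym) (eb : β → List Sym) (g : α → β) : Prop :=
  Nonempty (Turing.TM2ComputableInPolyTime ea eb g)

end ProxyRank

end

open ProxyRank

namespace ProxyRank

open Turing Computability

/-! In the scaled monomial basis a partial derivative only shifts coordinates: the entry of `M` in
row `I` and column `a` is the coordinate of `f` at `a + I` (`scaledCoeff_partialDeriv`,
`derivMatrix_apply`). All statements about `B` rest on this.

Lower bound: Cauchy-Schwarz over the nonzero eigenvalues of the symmetric matrix `B` gives Tr(B)² ≤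
rank(B) Tr(B²) (`trace_sq_div_le_rank`). Moreover rank(B) = rank(M), and the rows of `M` are
coordinate vectors of elements of the space of derivatives (`rank_derivMatrix_le`).

Trace formula: Tr(B²) is a sum over two columns a, b and two rows I, J of the product of the
coordinates at a + I, b + I, a + J, b + J. If P, Q, R are the first three exponents, the fourth is Q
+ R - P, and (a, b, I, J) is determined by (P, Q, R, I) (`trace_gram_mul_gram_eq`). Since P - R = I
- J, the sets I \ J and J \ I are forced, while I ∩ J is any subset of the right size of the zero
positions; this gives the binomial coefficient (`mem_rowSet_iff`, `rowCount_eq`).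

Polynomial time: program fragments for a four-stack machine are composed by sequence, branching and
loops, with running times attached. Data are binary trees in Polish notation on stack 0. The
functions in `PT` have polynomial running time and polynomial output size; they are closed under
composition, pairing, case distinction (`PT.branch`) and folds along lists whose intermediate
results stay polynomially small (`PT.foldl`). Binary arithmetic, parsing and the whole algorithm are
built from these closure properties, and `PT.polyTime` returns to words.

The algorithm works with natural numbers only. The coefficients are multiplied by a common
denominator, which does not change the proxy rank; Tr(B) is multiplied by k! and Tr(B²) by k!²,
which avoids divisions; positive and negative terms are summed separately. Loops run over the list
of monomials or over the n + 1 numbers up to n, never over the binary number k (`proxyFrac_spec`,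
`algorithm_spec`). -/

/-! ### Structured programs for multi-stack machines -/

/-- Statements of machines with four stacks over the alphabet `Sym`, whose internal state is a
buffer for one symbol. -/
abbrev Code (L : Type) : Type := TM2.Stmt (fun _ : Fin 4 => Sym) L (Option Sym)

/-- Configurations of such machines. -/
abbrev Conf (L : Type) : Type := TM2.Cfg (fun _ : Fin 4 => Sym) L (Option Sym)

/-- The contents of the four stacks. -/
def st (a b c d : List Sym) : Fin 4 → List Sym := ![a, b, c, d]

@[simp] theorem st_zero (a b c d : List Sym) : st a b c d 0 = a := rfl
@[simp] theorem st_one (a b c d : List Sym) : st a b c d 1 = b := rfl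
@[simp] theorem st_two (a b c d : List Sym) : st a b c d 2 = c := rfl
@[simp] theorem st_three (a b c d : List Sym) : st a b c d 3 = d := rfl

@[simp] theorem update_st_zero (a b c d x : List Sym) :
    Function.update (st a b c d) 0 x = st x b c d := by
  ext i; fin_cases i <;> rfl
@[simp] theorem update_st_one (a b c d x : List Sym) :
    Function.update (st a b c d) 1 x = st a x c d := by
  ext i; fin_cases i <;> rfl
@[simp] theorem update_st_three (a b c d x : List Sym) :
    Function.update (st a b c d) 3 x = st a b c x := by
  ext i; fin_cases i <;> rfl

/-- The machine goes from `c` to `c'` in at most `t` steps. -/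
def Within {L : Type} (M : L → Code L) (t : ℕ) (c c' : Conf L) : Prop :=
  ∃ n ≤ t, (flip Option.bind (TM2.step M))^[n] (some c) = some c'

theorem Within.trans {L : Type} {M : L → Code L} {s t : ℕ} {c c' c'' : Conf L}
    (h : Within M s c c') (h' : Within M t c' c'') : Within M (s + t) c c'' := by
  obtain ⟨n, hn, h⟩ := h
  obtain ⟨m, hm, h'⟩ := h'
  refine ⟨m + n, by omega, ?_⟩
  rw [Function.iterate_add_apply, h, h']

theorem Within.mono {L : Type} {M : L → Code L} {s t : ℕ} {c c' : Conf L}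
    (h : Within M s c c') (hst : s ≤ t) : Within M t c c' := by
  obtain ⟨n, hn, h⟩ := h
  exact ⟨n, hn.trans hst, h⟩

theorem Within.step {L : Type} {M : L → Code L} {l : L} {S : Fin 4 → List Sym} {c' : Conf L}
    (h : TM2.stepAux (M l) none S = c') : Within M 1 ⟨some l, none, S⟩ c' :=
  ⟨1, le_rfl, by subst h; rfl⟩

/-- A program fragment: code that can be placed in a larger program, given the positions of its
labels and the label at which the larger program continues. -/
structure Frag where
  Lab : Type
  fin : Fintype Lab
  start : Lab
  code : (L : Type) → (Lab → L) → L → Lab → Code L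

/-- The fragment `F` turns the stacks `S` into the stacks `S'` in at most `t` steps. -/
def Frag.Runs (F : Frag) (S : Fin 4 → List Sym) (t : ℕ) (S' : Fin 4 → List Sym) : Prop :=
  ∀ (L : Type) (e : F.Lab → L) (x : L) (M : L → Code L),
    (∀ l, M (e l) = F.code L e x l) → Within M t ⟨some (e F.start), none, S⟩ ⟨some x, none, S'⟩

theorem Frag.Runs.mono {F : Frag} {S S' : Fin 4 → List Sym} {s t : ℕ} (h : F.Runs S s S')
    (hst : s ≤ t) : F.Runs S t S' :=
  fun L e x M hM => (h L e x M hM).mono hst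

/-- Straight-line code, executed in one step. -/
def Frag.op (c : (L : Type) → Code L → Code L) : Frag where
  Lab := Unit
  fin := inferInstance
  start := ()
  code L _ x _ := c L (TM2.Stmt.goto fun _ => x)

theorem Frag.runs_op {c : (L : Type) → Code L → Code L} {S S' : Fin 4 → List Sym}
    (h : ∀ L x, TM2.stepAux (c L (TM2.Stmt.goto fun _ => x)) none S = ⟨some x, none, S'⟩) :
    (Frag.op c).Runs S 1 S' := by
  intro L e x M hM
  refine Within.step ?_
  rw [hM]
  exact h L x

/-- Sequential composition. -/
def Frag.seq (F G : Frag) : Frag where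
  Lab := F.Lab ⊕ G.Lab
  fin := letI := F.fin; letI := G.fin; inferInstance
  start := Sum.inl F.start
  code L e x := Sum.elim (F.code L (e ∘ Sum.inl) (e (Sum.inr G.start)))
    (G.code L (e ∘ Sum.inr) x)

/-- `Frag.Runs` quantifies over every surrounding program and every placement of the labels, so each
half can be instantiated inside the composite: the exit of `F` is the start of `G`. -/
theorem Frag.Runs.seq {F G : Frag} {S S' S'' : Fin 4 → List Sym} {s t : ℕ}
    (h : F.Runs S s S') (h' : G.Runs S' t S'') : (F.seq G).Runs S (s + t) S'' := by
  intro L e x M hM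
  exact (h L (e ∘ Sum.inl) (e (Sum.inr G.start)) M fun l => hM (Sum.inl l)).trans
    (h' L (e ∘ Sum.inr) x M fun l => hM (Sum.inr l))

/-- Branching on the top symbol of a stack. -/
def Frag.ite (k : Fin 4) (p : Option Sym → Bool) (F G : Frag) : Frag where
  Lab := Option (F.Lab ⊕ G.Lab)
  fin := letI := F.fin; letI := G.fin; inferInstance
  start := none
  code L e x
    | none => TM2.Stmt.peek k (fun _ s => s) (TM2.Stmt.branch p
        (TM2.Stmt.load (fun _ => none) (TM2.Stmt.goto fun _ => e (some (Sum.inl F.start))))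
        (TM2.Stmt.load (fun _ => none) (TM2.Stmt.goto fun _ => e (some (Sum.inr G.start)))))
    | some l => Sum.elim (F.code L (e ∘ some ∘ Sum.inl) x) (G.code L (e ∘ some ∘ Sum.inr) x) l

theorem Frag.Runs.ite_true {k : Fin 4} {p : Option Sym → Bool} {F G : Frag}
    {S S' : Fin 4 → List Sym} {t : ℕ} (hp : p (S k).head? = true) (h : F.Runs S t S') :
    (Frag.ite k p F G).Runs S (1 + t) S' := by
  intro L e x M hM
  refine Within.trans (c' := ⟨some (e (some (Sum.inl F.start))), none, S⟩) (Within.step ?_)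
    (h L (e ∘ some ∘ Sum.inl) x M fun l => hM (some (Sum.inl l)))
  erw [hM none]
  simp [Frag.ite, hp]

theorem Frag.Runs.ite_false {k : Fin 4} {p : Option Sym → Bool} {F G : Frag}
    {S S' : Fin 4 → List Sym} {t : ℕ} (hp : p (S k).head? = false) (h : G.Runs S t S') :
    (Frag.ite k p F G).Runs S (1 + t) S' := by
  intro L e x M hM
  refine Within.trans (c' := ⟨some (e (some (Sum.inr G.start))), none, S⟩) (Within.step ?_)
    (h L (e ∘ some ∘ Sum.inr) x M fun l => hM (some (Sum.inr l)))
  erw [hM none]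
  simp [Frag.ite, hp]

/-- Repetition as long as the top symbol of a stack satisfies a condition. -/
def Frag.loop (k : Fin 4) (p : Option Sym → Bool) (F : Frag) : Frag where
  Lab := Option F.Lab
  fin := letI := F.fin; inferInstance
  start := none
  code L e x
    | none => TM2.Stmt.peek k (fun _ s => s) (TM2.Stmt.branch p
        (TM2.Stmt.load (fun _ => none) (TM2.Stmt.goto fun _ => e (some F.start)))
        (TM2.Stmt.load (fun _ => none) (TM2.Stmt.goto fun _ => x)))
    | some l => F.code L (e ∘ some) (e none) l

theorem Frag.runs_loop_stop {k : Fin 4} {p : Option Sym → Bool} {F : Frag}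
    {S : Fin 4 → List Sym} (hp : p (S k).head? = false) : (Frag.loop k p F).Runs S 1 S := by
  intro L e x M hM
  refine Within.step ?_
  erw [hM none]
  simp [Frag.loop, hp]

/-- The exit label of the body is the label of the test, so one round costs the test plus the body
and ends in the initial situation of the same loop. -/
theorem Frag.Runs.loop_step {k : Fin 4} {p : Option Sym → Bool} {F : Frag}
    {S S' S'' : Fin 4 → List Sym} {s t : ℕ} (hp : p (S k).head? = true) (h : F.Runs S s S')
    (h' : (Frag.loop k p F).Runs S' t S'') : (Frag.loop k p F).Runs S (1 + s + t) S'' := by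
  intro L e x M hM
  refine Within.trans (Within.trans (c' := ⟨some (e (some F.start)), none, S⟩) (Within.step ?_)
    (h L (e ∘ some) (e none) M fun l => hM (some l))) (h' L e x M hM)
  erw [hM none]
  simp [Frag.loop, hp]

/-! ### Trees on stacks -/

/-- Binary trees. -/
inductive Tr : Type
  | nil : Tr
  | cons : Tr → Tr → Tr

/-- A tree as a word in Polish notation. -/
def Tr.enc : Tr → List Sym
  | .nil => [Γ'.comma]
  | .cons a b => Γ'.bra :: (a.enc ++ b.enc)

/-- The length of the word of a tree. -/
def Tr.size (t : Tr) : ℕ := t.enc.length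

@[simp] theorem Tr.size_nil : Tr.nil.size = 1 := rfl
@[simp] theorem Tr.size_cons (a b : Tr) : (Tr.cons a b).size = a.size + b.size + 1 := by
  simp [Tr.size, Tr.enc]

/-- Does the top symbol start a tree with two branches? -/
def isBra : Option Sym → Bool
  | some Γ'.bra => true
  | _ => false

/-- Is there a top symbol? -/
def nonempty : Option Sym → Bool := Option.isSome

open TM2.Stmt in
/-- Code that pops a symbol of stack `i`, pushes it on stack `j`, and updates the number of trees
still to be read, which is the height of stack `2`. -/
def moveSym (i j : Fin 4) : Frag := Frag.ite i isBra
    (Frag.op fun _ q => pop i (fun _ s => s) <| push j (fun s => s.getD Γ'.blank) <|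
      push 2 (fun _ => Γ'.blank) <| load (fun _ => none) q)
    (Frag.op fun _ q => pop i (fun _ s => s) <| push j (fun s => s.getD Γ'.blank) <|
      pop 2 (fun _ _ => none) q)

open TM2.Stmt in
/-- Code that moves the top tree of stack `i` in reversed form to stack `j`. -/
def moveTree (i j : Fin 4) : Frag :=
  (Frag.op fun _ q => push 2 (fun _ => Γ'.blank) q).seq (Frag.loop 2 nonempty (moveSym i j))

/-- Stack contents with `x` on stack `i`, `y` on stack `j` and `c` on stack `2`. -/
def upd3 (S : Fin 4 → List Sym) (i j : Fin 4) (x y c : List Sym) : Fin 4 → List Sym :=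
  Function.update (Function.update (Function.update S i x) j y) 2 c

/-- The height of stack `2` counts the trees still to be read. A `bra` replaces one pending tree by
two, hence the additional counter symbol; a `comma` completes a tree and removes one. -/
theorem runs_moveSym_bra {i j : Fin 4} (hij : i ≠ j) (hi : i ≠ 2) (hj : j ≠ 2)
    (S : Fin 4 → List Sym) (x y c : List Sym) :
    (moveSym i j).Runs (upd3 S i j (Γ'.bra :: x) y c) 2
      (upd3 S i j x (Γ'.bra :: y) (Γ'.blank :: c)) := by
  refine Frag.Runs.ite_true (by simp [upd3, hij, hi, isBra]) (Frag.runs_op fun L z => ?_)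
  simp [upd3, hij, hi, hj, hij.symm, hi.symm, hj.symm]
  ext k
  by_cases h2 : k = 2 <;> by_cases hkj : k = j <;> by_cases hki : k = i <;>
    simp_all [Function.update]

theorem runs_moveSym_comma {i j : Fin 4} (hij : i ≠ j) (hi : i ≠ 2) (hj : j ≠ 2)
    (S : Fin 4 → List Sym) (x y c : List Sym) :
    (moveSym i j).Runs (upd3 S i j (Γ'.comma :: x) y (Γ'.blank :: c)) 2
      (upd3 S i j x (Γ'.comma :: y) c) := by
  refine Frag.Runs.ite_false (by simp [upd3, hij, hi, isBra]) (Frag.runs_op fun L z => ?_)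
  simp [upd3, hij, hi, hj, hij.symm, hi.symm, hj.symm]
  ext k
  by_cases h2 : k = 2 <;> by_cases hkj : k = j <;> by_cases hki : k = i <;>
    simp_all [Function.update]

/-- The remaining run is a hypothesis with arbitrary final stacks. In this continuation form the
induction over the tree chains the two subtrees directly. Each symbol costs three steps: the loop
test, the branch and the move. -/
theorem runs_moveLoop {i j : Fin 4} (hij : i ≠ j) (hi : i ≠ 2) (hj : j ≠ 2)
    (S S' : Fin 4 → List Sym) (t : Tr) (x y c : List Sym) (s : ℕ)
    (h : (Frag.loop 2 nonempty (moveSym i j)).Runs (upd3 S i j x (t.enc.reverse ++ y) c) s S') :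
    (Frag.loop 2 nonempty (moveSym i j)).Runs (upd3 S i j (t.enc ++ x) y (Γ'.blank :: c))
      (3 * t.size + s) S' := by
  induction t generalizing x y c s with
  | nil =>
    refine (Frag.Runs.loop_step (by simp [upd3, nonempty]) (runs_moveSym_comma hij hi hj _ _ _ _)
      (by simpa [Tr.enc] using h)).mono ?_
    simp
  | cons a b iha ihb =>
    simp only [Tr.enc, List.cons_append, List.append_assoc]
    refine (Frag.Runs.loop_step (by simp [upd3, nonempty]) (runs_moveSym_bra hij hi hj _ _ _ _)
      (iha _ _ _ _ (ihb _ _ _ s ?_))).mono ?_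
    · simpa [Tr.enc] using h
    · simp; omega

/-- Stack `2` has to be empty at the start: then the counter reaches zero exactly at the end of the
tree, and the rest `x` of the stack stays untouched. -/
theorem runs_moveTree {i j : Fin 4} (hij : i ≠ j) (hi : i ≠ 2) (hj : j ≠ 2)
    (S : Fin 4 → List Sym) (t : Tr) (x y : List Sym) :
    (moveTree i j).Runs (upd3 S i j (t.enc ++ x) y []) (3 * t.size + 2)
      (upd3 S i j x (t.enc.reverse ++ y) []) := by
  refine (Frag.Runs.seq (Frag.runs_op (S' := upd3 S i j (t.enc ++ x) y [Γ'.blank]) fun L z => ?_)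
    (runs_moveLoop hij hi hj S _ t x y [] 1 (Frag.runs_loop_stop (by simp [upd3, nonempty])))).mono
      (by omega)
  simp [upd3]

end ProxyRank

namespace ProxyRank

open Turing Computability

/-! ### Moving, copying and swapping trees on the stacks -/

open TM2.Stmt in
/-- Code that moves the top symbol of stack `i` to stack `j`. -/
def popPush (i j : Fin 4) : Frag :=
  Frag.op fun _ q => pop i (fun _ s => s) <| push j (fun s => s.getD Γ'.blank) <|
    load (fun _ => none) q

/-- Code that moves all of stack `i` to stack `j`. -/
def moveAll (i j : Fin 4) : Frag := Frag.loop i nonempty (popPush i j)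

theorem runs_moveAll_one_zero (a b c d : List Sym) :
    (moveAll 1 0).Runs (st a b c d) (2 * b.length + 1) (st (b.reverse ++ a) [] c d) := by
  induction b generalizing a with
  | nil => exact Frag.runs_loop_stop rfl
  | cons s b ih =>
    have h := Frag.Runs.loop_step (k := 1) (p := nonempty) (F := popPush 1 0)
      (S := st a (s :: b) c d) (S' := st (s :: a) b c d) rfl
      (Frag.runs_op fun L z => by simp) (ih (s :: a))
    simpa [moveAll] using h.mono (t := 2 * (b.length + 1) + 1) (by omega)

theorem runs_moveAll_zero_one (a b c d : List Sym) :
    (moveAll 0 1).Runs (st a b c d) (2 * a.length + 1) (st [] (a.reverse ++ b) c d) := by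
  induction a generalizing b with
  | nil => exact Frag.runs_loop_stop rfl
  | cons s a ih =>
    have h := Frag.Runs.loop_step (k := 0) (p := nonempty) (F := popPush 0 1)
      (S := st (s :: a) b c d) (S' := st a (s :: b) c d) rfl
      (Frag.runs_op fun L z => by simp) (ih (s :: b))
    simpa [moveAll] using h.mono (t := 2 * (a.length + 1) + 1) (by omega)

theorem runs_moveAll_three_zero (a b c d : List Sym) :
    (moveAll 3 0).Runs (st a b c d) (2 * d.length + 1) (st (d.reverse ++ a) b c []) := by
  induction d generalizing a with
  | nil => exact Frag.runs_loop_stop rfl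
  | cons s d ih =>
    have h := Frag.Runs.loop_step (k := 3) (p := nonempty) (F := popPush 3 0)
      (S := st a b c (s :: d)) (S' := st (s :: a) b c d) rfl
      (Frag.runs_op fun L z => by simp) (ih (s :: a))
    simpa [moveAll] using h.mono (t := 2 * (d.length + 1) + 1) (by omega)

theorem runs_moveAll_three_one (a b c d : List Sym) :
    (moveAll 3 1).Runs (st a b c d) (2 * d.length + 1) (st a (d.reverse ++ b) c []) := by
  induction d generalizing b with
  | nil => exact Frag.runs_loop_stop rfl
  | cons s d ih =>
    have h := Frag.Runs.loop_step (k := 3) (p := nonempty) (F := popPush 3 1)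
      (S := st a b c (s :: d)) (S' := st a (s :: b) c d) rfl
      (Frag.runs_op fun L z => by simp) (ih (s :: b))
    simpa [moveAll] using h.mono (t := 2 * (d.length + 1) + 1) (by omega)

open TM2.Stmt in
/-- Code that empties stack `1`. -/
def clear : Frag := Frag.loop 1 nonempty (Frag.op fun _ q => pop 1 (fun _ _ => none) q)

theorem runs_clear (a b c d : List Sym) :
    clear.Runs (st a b c d) (2 * b.length + 1) (st a [] c d) := by
  induction b with
  | nil => exact Frag.runs_loop_stop rfl
  | cons s b ih =>
    exact (Frag.Runs.loop_step (k := 1) (p := nonempty) (S' := st a b c d) rfl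
      (Frag.runs_op fun L z => by simp) ih).mono (by simp; omega)

open TM2.Stmt in
/-- Code that moves stack `1` to stack `0` and to stack `3`. -/
def split : Frag := Frag.loop 1 nonempty <| Frag.op fun _ q => pop 1 (fun _ s => s) <|
  push 0 (fun s => s.getD Γ'.blank) <| push 3 (fun s => s.getD Γ'.blank) <|
    load (fun _ => none) q

theorem runs_split (a b c d : List Sym) :
    split.Runs (st a b c d) (2 * b.length + 1) (st (b.reverse ++ a) [] c (b.reverse ++ d)) := by
  induction b generalizing a d with
  | nil => exact Frag.runs_loop_stop rfl
  | cons s b ih =>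
    have h := Frag.Runs.loop_step (k := 1) (p := nonempty)
      (S := st a (s :: b) c d) (S' := st (s :: a) b c (s :: d)) rfl
      (Frag.runs_op fun L z => by simp) (ih (s :: a) (s :: d))
    simpa [split] using h.mono (t := 2 * (b.length + 1) + 1) (by omega)

theorem upd3_zero_one (S : Fin 4 → List Sym) (x y c : List Sym) :
    upd3 S 0 1 x y c = st x y c (S 3) := by
  ext i; fin_cases i <;> rfl

theorem upd3_zero_three (S : Fin 4 → List Sym) (x y c : List Sym) :
    upd3 S 0 3 x y c = st x (S 1) c y := by
  ext i; fin_cases i <;> rfl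

theorem runs_moveTree_zero_one (t : Tr) (a b d : List Sym) :
    (moveTree 0 1).Runs (st (t.enc ++ a) b [] d) (3 * t.size + 2)
      (st a (t.enc.reverse ++ b) [] d) := by
  simpa [upd3_zero_one] using
    runs_moveTree (i := 0) (j := 1) (by decide) (by decide) (by decide) (st [] [] [] d) t a b

theorem runs_moveTree_zero_three (t : Tr) (a b d : List Sym) :
    (moveTree 0 3).Runs (st (t.enc ++ a) b [] d) (3 * t.size + 2)
      (st a b [] (t.enc.reverse ++ d)) := by
  simpa [upd3_zero_three] using
    runs_moveTree (i := 0) (j := 3) (by decide) (by decide) (by decide) (st [] b [] []) t a d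

/-- Stack contents with the given word on stack `0`. -/
abbrev st₀ (a : List Sym) : Fin 4 → List Sym := st a [] [] []

/-- Code that drops the top tree. -/
def drop : Frag := (moveTree 0 1).seq clear

theorem runs_drop (t : Tr) (a : List Sym) :
    drop.Runs (st₀ (t.enc ++ a)) (5 * t.size + 3) (st₀ a) :=
  ((runs_moveTree_zero_one t a [] []).seq (runs_clear _ _ _ _)).mono (by simp [Tr.size]; omega)

/-- Code that duplicates the top tree. -/
def dup : Frag := (moveTree 0 1).seq (split.seq ((moveAll 3 1).seq (moveAll 1 0)))

theorem runs_dup (t : Tr) (a : List Sym) :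
    dup.Runs (st₀ (t.enc ++ a)) (9 * t.size + 5) (st₀ (t.enc ++ (t.enc ++ a))) := by
  -- Every move reverses a word. The tree lies reversed on stack 1, so `split` leaves two upright
  -- copies on stacks 0 and 3; the second copy travels through stack 1 to arrive upright on stack 0.
  have h := (runs_moveTree_zero_one t a [] []).seq ((runs_split _ _ _ _).seq
    ((runs_moveAll_three_one _ _ _ _).seq (runs_moveAll_one_zero _ _ _ _)))
  simpa [dup] using h.mono (t := 9 * t.size + 5) (by simp [Tr.size]; omega)

/-- Code that swaps the two top trees. -/
def swap : Frag := (moveTree 0 1).seq ((moveTree 0 3).seq ((moveAll 1 0).seq (moveAll 3 0)))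

theorem runs_swap (t u : Tr) (a : List Sym) :
    swap.Runs (st₀ (t.enc ++ (u.enc ++ a))) (5 * t.size + 5 * u.size + 6)
      (st₀ (u.enc ++ (t.enc ++ a))) := by
  have h := (runs_moveTree_zero_one t (u.enc ++ a) [] []).seq
    ((runs_moveTree_zero_three u a _ []).seq
    ((runs_moveAll_one_zero _ _ _ _).seq (runs_moveAll_three_zero _ _ _ _)))
  simpa [swap] using h.mono (t := 5 * t.size + 5 * u.size + 6) (by simp [Tr.size]; omega)

open TM2.Stmt in
/-- Code that pops a symbol. -/
def pop₀ : Frag := Frag.op fun _ q => pop 0 (fun _ _ => none) q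

theorem runs_pop₀ (s : Sym) (a : List Sym) : pop₀.Runs (st₀ (s :: a)) 1 (st₀ a) :=
  Frag.runs_op fun L z => by simp

open TM2.Stmt in
/-- Code that pushes a symbol. -/
def push₀ (s : Sym) : Frag := Frag.op fun _ q => push 0 (fun _ => s) q

theorem runs_push₀ (s : Sym) (a : List Sym) : (push₀ s).Runs (st₀ a) 1 (st₀ (s :: a)) :=
  Frag.runs_op fun L z => by simp

/-! ### Functions computed in polynomial time -/

/-- A representation of the elements of a type by trees. -/
class TreeRep (α : Type) where
  rep : α → Tr

open ProxyRank.TreeRep (rep)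

/-- The size of the representation of an element. -/
def sz {α : Type} [TreeRep α] (x : α) : ℕ := (rep x).size

instance : TreeRep Tr := ⟨id⟩
instance : TreeRep Unit := ⟨fun _ => .nil⟩
instance : TreeRep Bool := ⟨fun b => bif b then .cons .nil .nil else .nil⟩
instance {α β : Type} [TreeRep α] [TreeRep β] : TreeRep (α × β) := ⟨fun p => .cons (rep p.1) (rep p.2)⟩
-- A nonempty list has the same tree as the pair of its head and its tail, so pairing and
-- projections also serve as list operations.
instance {α : Type} [TreeRep α] : TreeRep (List α) := ⟨fun l => l.foldr (fun a t => .cons (rep a) t) .nil⟩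
instance : TreeRep ℕ := ⟨fun n => rep n.bits⟩

/-- Time bounds have natural coefficients and are therefore monotone, so a bound on the size of an
intermediate value can be substituted into the next time bound. -/
theorem monotone_eval (p : Polynomial ℕ) : Monotone fun n => p.eval n := by
  intro a b h
  induction p using Polynomial.induction_on' with
  | add p q hp hq => simpa using add_le_add hp hq
  | monomial n c => simpa using Nat.mul_le_mul_left c (Nat.pow_le_pow_left h n)

variable {α β γ δ ε : Type} [TreeRep α] [TreeRep β] [TreeRep γ] [TreeRep δ] [TreeRep ε]

theorem rep_pair (x : α) (y : β) : rep (x, y) = .cons (rep x) (rep y) := rfl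

@[simp] theorem sz_pair (x : α) (y : β) : sz (x, y) = sz x + sz y + 1 := by simp [sz, rep]
@[simp] theorem sz_nil : sz ([] : List α) = 1 := rfl
@[simp] theorem sz_cons (x : α) (l : List α) : sz (x :: l) = sz x + sz l + 1 := by simp [sz, rep]

/-- The function `f` is computed by a program fragment in polynomial time, and the size of its
values is bounded by a polynomial. -/
structure PT (f : α → β) : Prop where
  exists_program : ∃ (F : Frag) (p : Polynomial ℕ), ∀ x,
    (∀ r, F.Runs (st₀ ((rep x).enc ++ r)) (p.eval (sz x)) (st₀ ((rep (f x)).enc ++ r))) ∧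
      sz (f x) ≤ p.eval (sz x)

theorem PT.of_rep {f : α → β} (h : ∀ x, rep (f x) = rep x) : PT f := by
  refine ⟨Frag.op fun _ q => q, 1 + Polynomial.X, fun x => ⟨fun r => ?_, ?_⟩⟩
  · rw [h]
    exact (Frag.runs_op fun L z => by simp).mono (by simp)
  · simp [sz, h]

theorem PT.id : PT (fun x : α => x) := PT.of_rep fun _ => rfl

theorem PT.congr_rep {f : α → β} {g : α → γ} (hf : PT f) (h : ∀ x, rep (f x) = rep (g x)) :
    PT g := by
  obtain ⟨F, p, hF⟩ := hf
  refine ⟨F, p, fun x => ?_⟩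
  simpa [sz, h] using hF x

/-- This is where the size bound in `PT` is used: the time of `f` is measured in the size of `g x`.
-/
theorem PT.comp {f : β → γ} {g : α → β} (hf : PT f) (hg : PT g) : PT fun x => f (g x) := by
  obtain ⟨F, p, hF⟩ := hf
  obtain ⟨G, q, hG⟩ := hg
  refine ⟨G.seq F, q + p.comp q, fun x => ⟨fun r => ?_, ?_⟩⟩
  · refine (((hG x).1 r).seq ((hF (g x)).1 r)).mono ?_
    simpa using monotone_eval p (hG x).2
  · refine (hF (g x)).2.trans ?_
    simpa using (monotone_eval p (hG x).2).trans (Nat.le_add_left _ _)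

theorem PT.fst' : PT fun x : α × β => x.1 := by
  refine ⟨pop₀.seq (swap.seq drop), 10 * Polynomial.X + 10, fun x => ⟨fun r => ?_, ?_⟩⟩
  · have h := (runs_pop₀ Γ'.bra ((rep x.1).enc ++ ((rep x.2).enc ++ r))).seq
      ((runs_swap (rep x.1) (rep x.2) r).seq (runs_drop (rep x.2) ((rep x.1).enc ++ r)))
    simpa [rep, Tr.enc] using h.mono (t := 10 * sz x + 10) (by simp [sz, rep]; omega)
  · have : sz x = sz x.1 + sz x.2 + 1 := sz_pair _ _
    simp; omega

theorem PT.snd' : PT fun x : α × β => x.2 := by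
  refine ⟨pop₀.seq drop, 10 * Polynomial.X + 10, fun x => ⟨fun r => ?_, ?_⟩⟩
  · have h := (runs_pop₀ Γ'.bra ((rep x.1).enc ++ ((rep x.2).enc ++ r))).seq
      (runs_drop (rep x.1) ((rep x.2).enc ++ r))
    simpa [rep, Tr.enc] using h.mono (t := 10 * sz x + 10) (by simp [sz, rep]; omega)
  · have : sz x = sz x.1 + sz x.2 + 1 := sz_pair _ _
    simp; omega

theorem PT.fst {f : γ → α × β} (hf : PT f) : PT fun x => (f x).1 := PT.fst'.comp hf

theorem PT.snd {f : γ → α × β} (hf : PT f) : PT fun x => (f x).2 := PT.snd'.comp hf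

/-- The argument is duplicated, `g` is evaluated on the top copy, the other copy is swapped to the
top and `f` is evaluated there. The two values then lie in the order in which a pair lists them, and
only the leading `bra` is missing. -/
theorem PT.pair {f : γ → α} {g : γ → β} (hf : PT f) (hg : PT g) : PT fun x => (f x, g x) := by
  obtain ⟨F, p, hF⟩ := hf
  obtain ⟨G, q, hG⟩ := hg
  refine ⟨dup.seq (G.seq (swap.seq (F.seq (push₀ Γ'.bra)))),
    14 * Polynomial.X + p + 6 * q + 12, fun x => ⟨fun r => ?_, ?_⟩⟩
  · have h := (runs_dup (rep x) r).seq (((hG x).1 ((rep x).enc ++ r)).seq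
      ((runs_swap (rep (g x)) (rep x) r).seq (((hF x).1 ((rep (g x)).enc ++ r)).seq
        (runs_push₀ Γ'.bra _))))
    have h1 := (hG x).2
    simpa [rep, Tr.enc] using h.mono
      (t := 14 * sz x + p.eval (sz x) + 6 * q.eval (sz x) + 12) (by simp only [sz] at *; omega)
  · have h1 := (hF x).2
    have h2 := (hG x).2
    simp; omega

theorem PT.nil : PT fun _ : γ => Tr.nil := by
  refine ⟨drop.seq (push₀ Γ'.comma), 5 * Polynomial.X + 4, fun x => ⟨fun r => ?_, ?_⟩⟩
  · exact ((runs_drop (rep x) r).seq (runs_push₀ Γ'.comma r)).mono (by simp [sz])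
  · simp [sz, rep]

theorem PT.const (b : β) : PT fun _ : γ => b := by
  have h (t : Tr) : PT fun _ : γ => t := by
    induction t with
    | nil => exact PT.nil
    | cons a b iha ihb => exact (iha.pair ihb).congr_rep fun _ => rfl
  exact (h (rep b)).congr_rep fun _ => rfl

/-- All case distinctions reduce to this one, on whether a tree is `nil`. The nonempty case may
reinterpret the tree of `c x` as that of an element of another type `β`, which covers lists (head
and tail) and Booleans alike. -/
theorem PT.branch {c : γ → α} {f : γ → δ} {g : β × γ → δ} {k : γ → δ} (hc : PT c) (hf : PT f)
    (hg : PT g) (h : ∀ x, (rep (c x) = .nil ∧ k x = f x) ∨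
      ∃ y : β, rep (c x) = rep y ∧ (∃ a b, rep y = .cons a b) ∧ k x = g (y, x)) : PT k := by
  have hd : PT fun x => (c x, x) := hc.pair PT.id
  suffices H : ∃ (F : Frag) (p : Polynomial ℕ), ∀ x,
      (∀ r, F.Runs (st₀ ((rep (c x, x)).enc ++ r)) (p.eval (sz (c x, x)))
        (st₀ ((rep (k x)).enc ++ r))) ∧ sz (k x) ≤ p.eval (sz (c x, x)) by
    obtain ⟨F, p, hF⟩ := H
    obtain ⟨G, q, hG⟩ := hd
    refine ⟨G.seq F, q + p.comp q, fun x => ⟨fun r => ?_, ?_⟩⟩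
    · refine (((hG x).1 r).seq ((hF x).1 r)).mono ?_
      simpa using monotone_eval p (hG x).2
    · refine (hF x).2.trans ?_
      simpa using (monotone_eval p (hG x).2).trans (Nat.le_add_left _ _)
  obtain ⟨F, p, hF⟩ := hf
  obtain ⟨G, q, hG⟩ := hg
  -- Popping the `bra` of the pair exposes the first symbol of `c x`. If it is a `bra`, the popped
  -- symbol is restored and `G` gets the whole pair; otherwise the `comma` of the empty tree is
  -- dropped and `F` gets `x`.
  refine ⟨pop₀.seq (Frag.ite 0 isBra ((push₀ Γ'.bra).seq G) (pop₀.seq F)), p + q + 3,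
    fun x => ?_⟩
  rcases h x with ⟨hx, hk⟩ | ⟨y, hy, ⟨a, b, hab⟩, hk⟩
  · have hm : p.eval (sz x) ≤ p.eval (sz (c x, x)) := monotone_eval p (by simp; omega)
    rw [hk]
    refine ⟨fun r => ?_, ?_⟩
    · have h := (runs_pop₀ Γ'.bra (Γ'.comma :: ((rep x).enc ++ r))).seq
        (Frag.Runs.ite_false (k := 0) (p := isBra) (F := (push₀ Γ'.bra).seq G) rfl
          ((runs_pop₀ Γ'.comma _).seq ((hF x).1 r)))
      have hr : (rep (c x, x)).enc = Γ'.bra :: Γ'.comma :: (rep x).enc := by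
        simp [rep_pair, Tr.enc, hx]
      rw [hr]
      exact h.mono (by simp only [Polynomial.eval_add, Polynomial.eval_ofNat]; omega)
    · have := (hF x).2
      simp only [Polynomial.eval_add, Polynomial.eval_ofNat]; omega
  · have hr : rep (c x, x) = rep (y, x) := by rw [rep_pair, rep_pair, hy]
    have hs : sz (c x, x) = sz (y, x) := by rw [sz, sz, hr]
    have hr2 (r : List Sym) : (rep (y, x)).enc ++ r =
        Γ'.bra :: (Γ'.bra :: (a.enc ++ b.enc ++ (rep x).enc ++ r)) := by
      simp [rep_pair, Tr.enc, hab]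
    rw [hk, hs, hr]
    refine ⟨fun r => ?_, ?_⟩
    · have h := (runs_pop₀ Γ'.bra (Γ'.bra :: (a.enc ++ b.enc ++ (rep x).enc ++ r))).seq
        (Frag.Runs.ite_true (k := 0) (p := isBra) (G := pop₀.seq F) rfl
          ((runs_push₀ Γ'.bra _).seq (hr2 r ▸ (hG (y, x)).1 r)))
      rw [hr2]
      exact h.mono (by simp; omega)
    · have := (hG (y, x)).2
      simp at *; omega

theorem PT.list_cases {l : γ → List α} {f : γ → δ} {g : γ → α → List α → δ} {k : γ → δ}
    (hl : PT l) (hf : PT f) (hg : PT fun x : (α × List α) × γ => g x.2 x.1.1 x.1.2)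
    (h0 : ∀ x, l x = [] → k x = f x) (h1 : ∀ x a l', l x = a :: l' → k x = g x a l') : PT k := by
  refine PT.branch hl hf hg fun x => ?_
  rcases hx : l x with _ | ⟨a, l'⟩
  · exact Or.inl ⟨rfl, h0 x hx⟩
  · exact Or.inr ⟨(a, l'), rfl, ⟨_, _, rfl⟩, h1 x a l' hx⟩

theorem PT.cond {c : γ → Bool} {f g : γ → δ} (hc : PT c) (hf : PT f) (hg : PT g) :
    PT fun x => bif c x then f x else g x := by
  -- The tree of `true` is also the tree of `((), ())`.
  refine PT.branch (β := Unit × Unit) hc hg (hf.comp PT.snd') fun x => ?_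
  cases hx : c x
  · exact Or.inl ⟨rfl, rfl⟩
  · exact Or.inr ⟨((), ()), rfl, ⟨_, _, rfl⟩, rfl⟩

theorem PT.cons {f : γ → α} {g : γ → List α} (hf : PT f) (hg : PT g) :
    PT fun x => f x :: g x :=
  (hf.pair hg).congr_rep fun _ => rfl

theorem PT.tail {l : γ → List α} (hl : PT l) : PT fun x => (l x).tail :=
  PT.list_cases (g := fun _ _ l' => l') hl (PT.const []) PT.fst'.snd (by simp +contextual)
    (by simp +contextual)

theorem PT.headD {l : γ → List α} {d : γ → α} (hl : PT l) (hd : PT d) :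
    PT fun x => (l x).headD (d x) :=
  PT.list_cases (g := fun _ a _ => a) hl hd PT.fst'.fst (by simp +contextual)
    (by simp +contextual)

theorem PT.isEmpty {l : γ → List α} (hl : PT l) : PT fun x => (l x).isEmpty :=
  PT.list_cases (g := fun _ _ _ => false) hl (PT.const true) (PT.const false)
    (by simp +contextual) (by simp +contextual)

/-! ### Iteration along lists -/

/-- Between rounds the list and the accumulator lie on the stack without the `bra` of their pair, so
the loop test sees whether the list is empty. Since `a :: l` and `(a, l)` have the same tree,
pushing one `bra` produces the argument of `h`. The number `K` bounds the size of every state that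
occurs, hence the time of each round. -/
theorem runs_fold {β : Type} [TreeRep β] {h : (α × List α) × β → List α × β} {F : Frag}
    {p : Polynomial ℕ}
    (hF : ∀ x, ∀ r, F.Runs (st₀ ((rep x).enc ++ r)) (p.eval (sz x)) (st₀ ((rep (h x)).enc ++ r)))
    (g : β → α → β) (hg : ∀ a l b, h ((a, l), b) = (l, g b a)) (K : ℕ) (l : List α) (b : β)
    (hK : ∀ l₁, l₁ <+: l → sz l + sz (l₁.foldl g b) + 1 ≤ K) (r : List Sym) :
    (Frag.loop 0 isBra ((push₀ Γ'.bra).seq (F.seq pop₀))).Runs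
      (st₀ ((rep l).enc ++ ((rep b).enc ++ r))) ((p.eval K + 3) * l.length + 1)
      (st₀ (Γ'.comma :: ((rep (l.foldl g b)).enc ++ r))) := by
  induction l generalizing b with
  | nil => exact (Frag.runs_loop_stop rfl).mono (by simp)
  | cons a l ih =>
    have hr : (rep ((a, l), b)).enc ++ r =
        Γ'.bra :: ((rep (a :: l)).enc ++ ((rep b).enc ++ r)) := by
      simp [rep, Tr.enc]
    have hr2 : (rep (l, g b a)).enc ++ r =
        Γ'.bra :: ((rep l).enc ++ ((rep (g b a)).enc ++ r)) := by
      simp [rep, Tr.enc]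
    have h1 := hF ((a, l), b) r
    rw [hg, hr, hr2] at h1
    have h2 := ih (g b a) fun l₁ hl₁ => by
      have := hK (a :: l₁) (List.prefix_cons_inj a |>.2 hl₁)
      simp at this; omega
    refine (Frag.Runs.loop_step ?_ ((runs_push₀ Γ'.bra _).seq (h1.seq (runs_pop₀ _ _))) h2).mono ?_
    · simp [rep, Tr.enc, isBra]
    · have h3 : p.eval (sz ((a, l), b)) ≤ p.eval K := monotone_eval p <| by
        have := hK [] (List.nil_prefix)
        simp at *; omega
      simp only [List.length_cons]
      ring_nf at *
      omega

theorem length_le_sz (l : List α) : l.length ≤ sz l := by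
  induction l with
  | nil => simp
  | cons a l ih => simp; omega

theorem sz_le_of_mem {a : α} {l : List α} (h : a ∈ l) : sz a ≤ sz l := by
  induction l with
  | nil => simp at h
  | cons b l ih =>
    rcases List.mem_cons.1 h with rfl | h
    · simp; omega
    · have := ih h
      simp; omega

/-- Iteration along a list, if the size of all intermediate results is bounded. -/
theorem PT.foldl {l : γ → List α} {b : γ → β} {g : γ → β → α → β} (hl : PT l) (hb : PT b)
    (hg : PT fun x : γ × β × α => g x.1 x.2.1 x.2.2) (Q : Polynomial ℕ)
    (hQ : ∀ x l₁, l₁ <+: l x → sz (l₁.foldl (g x) (b x)) ≤ Q.eval (sz x)) :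
    PT fun x => (l x).foldl (g x) (b x) := by
  -- The parameter `x` travels along in the accumulator, because the body of the loop sees nothing
  -- else; it is projected away at the end.
  have hd : PT fun x => (l x, (b x, x)) := hl.pair (hb.pair PT.id)
  have hh : PT fun x : (α × List α) × (β × γ) => (x.1.2, (g x.2.2 x.2.1 x.1.1, x.2.2)) :=
    (PT.fst'.snd).pair ((hg.comp (PT.snd'.snd.pair (PT.snd'.fst.pair PT.fst'.fst))).pair
      PT.snd'.snd)
  obtain ⟨F, p, hF⟩ := hh
  obtain ⟨G, q, hG⟩ := hd
  suffices PT fun x => ((l x).foldl (g x) (b x), x) from this.fst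
  refine ⟨G.seq (pop₀.seq ((Frag.loop 0 isBra ((push₀ Γ'.bra).seq (F.seq pop₀))).seq pop₀)),
    (p.comp (q + Q + Polynomial.X + 2) + 3) * q + q + 3 + Q + Polynomial.X,
    fun x => ⟨fun r => ?_, ?_⟩⟩
  · have hfold (l' : List α) : l'.foldl (fun (s : β × γ) a => (g s.2 s.1 a, s.2)) (b x, x) =
        (l'.foldl (g x) (b x), x) := by
      generalize b x = c
      induction l' generalizing c with
      | nil => rfl
      | cons a l' ih => simp [ih]
    have hs := (hG x).2
    have hlen := length_le_sz (l x)
    simp only [sz_pair] at hs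
    have h1 := runs_fold (fun x => (hF x).1) (fun (s : β × γ) a => (g s.2 s.1 a, s.2))
      (fun _ _ _ => rfl) (q.eval (sz x) + Q.eval (sz x) + sz x + 2) (l x) (b x, x)
      (fun l₁ hl₁ => by
        rw [hfold]
        have := hQ x l₁ hl₁
        simp; omega) r
    rw [hfold] at h1
    have h0 := (hG x).1 r
    have hr : (rep (l x, (b x, x))).enc ++ r =
        Γ'.bra :: ((rep (l x)).enc ++ ((rep (b x, x)).enc ++ r)) := by
      simp [rep, Tr.enc]
    rw [hr] at h0
    refine (h0.seq ((runs_pop₀ _ _).seq (h1.seq (runs_pop₀ _ _)))).mono ?_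
    simp only [Polynomial.eval_add, Polynomial.eval_mul, Polynomial.eval_comp, Polynomial.eval_X,
      Polynomial.eval_ofNat]
    have h2 := Nat.mul_le_mul_left
      (p.eval (q.eval (sz x) + Q.eval (sz x) + sz x + 2) + 3) (hlen.trans (by omega : _ ≤ q.eval (sz x)))
    omega
  · have := hQ x (l x) List.prefix_rfl
    simp; omega

omit [TreeRep α] [TreeRep β] in
theorem measure_foldl_le (μ : β → ℕ) (g : β → α → β) (K : ℕ) (l : List α) (b : β)
    (h : ∀ b, ∀ a ∈ l, μ (g b a) ≤ μ b + K) : μ (l.foldl g b) ≤ μ b + K * l.length := by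
  induction l generalizing b with
  | nil => simp
  | cons a l ih =>
    have h1 := h b a (by simp)
    have h2 := ih (g b a) fun b' a' ha' => h b' a' (by simp [ha'])
    simp only [List.foldl_cons, List.length_cons]
    ring_nf at *
    omega

/-- Iteration along a list, if a measure of the size of the results grows by a bounded amount in
each step. -/
theorem PT.foldl_measure {l : γ → List α} {b : γ → β} {g : γ → β → α → β} (hl : PT l) (hb : PT b)
    (hg : PT fun x : γ × β × α => g x.1 x.2.1 x.2.2) (μ : β → ℕ) (h1μ : ∀ b, μ b ≤ sz b)
    (h2μ : ∀ b, sz b ≤ 4 * μ b + 4) (q : Polynomial ℕ)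
    (hq : ∀ x b, ∀ a ∈ l x, μ (g x b a) ≤ μ b + q.eval (sz x + sz a)) :
    PT fun x => (l x).foldl (g x) (b x) := by
  obtain ⟨F, p, hF⟩ := _root_.id hl
  obtain ⟨F', p', hF'⟩ := _root_.id hb
  refine PT.foldl hl hb hg (4 * (p' + q.comp (Polynomial.X + p) * p) + 4) fun x l₁ hl₁ => ?_
  have h1 := (hF x).2
  have h2 := (h1μ _).trans (hF' x).2
  have h3 := measure_foldl_le μ (g x) (q.eval (sz x + p.eval (sz x))) l₁ (b x) fun b' a ha => by
    have ha := hl₁.subset ha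
    exact (hq x b' a ha).trans (Nat.add_le_add_left (monotone_eval q
      (Nat.add_le_add_left ((sz_le_of_mem ha).trans h1) _)) _)
  have h4 : l₁.length ≤ p.eval (sz x) := hl₁.length_le.trans ((length_le_sz _).trans h1)
  have h5 := Nat.mul_le_mul_left (q.eval (sz x + p.eval (sz x))) h4
  have h6 := h2μ (l₁.foldl (g x) (b x))
  simp only [Polynomial.eval_add, Polynomial.eval_mul, Polynomial.eval_comp, Polynomial.eval_X,
    Polynomial.eval_ofNat]
  omega

/-- Iteration along a list, if the size of the results grows by a bounded amount in each step. -/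
theorem PT.foldl_add {l : γ → List α} {b : γ → β} {g : γ → β → α → β} (hl : PT l) (hb : PT b)
    (hg : PT fun x : γ × β × α => g x.1 x.2.1 x.2.2) (q : Polynomial ℕ)
    (hq : ∀ x b, ∀ a ∈ l x, sz (g x b a) ≤ sz b + q.eval (sz x + sz a)) :
    PT fun x => (l x).foldl (g x) (b x) :=
  PT.foldl_measure hl hb hg sz (fun _ => le_rfl) (fun _ => by omega) q hq

end ProxyRank

namespace ProxyRank

open Turing Computability
open ProxyRank.TreeRep (rep)

variable {α β γ δ ε : Type} [TreeRep α] [TreeRep β] [TreeRep γ] [TreeRep δ] [TreeRep ε]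

/-! ### Lists -/

theorem PT.sz_le {f : α → β} (hf : PT f) : ∃ p : Polynomial ℕ, ∀ x, sz (f x) ≤ p.eval (sz x) := by
  obtain ⟨F, p, hF⟩ := hf
  exact ⟨p, fun x => (hF x).2⟩

/-- A fold that prepends its results reverses the list. The case of the identity gives `PT.reverse`,
and a second reversal gives `PT.map`. -/
theorem PT.map_reverse {l : γ → List α} {g : γ → α → β} (hl : PT l)
    (hg : PT fun x : γ × α => g x.1 x.2) : PT fun x => ((l x).map (g x)).reverse := by
  obtain ⟨p, hp⟩ := hg.sz_le
  have h : PT fun x => (l x).foldl (fun acc a => g x a :: acc) [] := by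
    refine PT.foldl_add hl (PT.const []) (PT.cons (hg.comp (PT.fst'.pair PT.snd'.snd)) PT.snd'.fst)
      (p.comp (Polynomial.X + 1) + 1) fun x b a _ => ?_
    have := hp (x, a)
    simp at *; omega
  convert h using 2 with x
  have h (m : List α) (acc : List β) :
      m.foldl (fun acc a => g x a :: acc) acc = (m.map (g x)).reverse ++ acc := by
    induction m generalizing acc with
    | nil => rfl
    | cons a m ih => simp [ih]
  simp [h]

theorem PT.reverse {l : γ → List α} (hl : PT l) : PT fun x => (l x).reverse := by
  simpa using PT.map_reverse hl (g := fun _ a => a) PT.snd'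

theorem PT.map {l : γ → List α} {g : γ → α → β} (hl : PT l)
    (hg : PT fun x : γ × α => g x.1 x.2) : PT fun x => (l x).map (g x) := by
  simpa using (PT.map_reverse hl hg).reverse

theorem PT.append {l m : γ → List α} (hl : PT l) (hm : PT m) : PT fun x => l x ++ m x := by
  have h : PT fun x => (l x).reverse.foldl (fun acc a => a :: acc) (m x) :=
    PT.foldl_add hl.reverse hm (PT.cons PT.snd'.snd PT.snd'.fst) (Polynomial.X + 1)
      fun x b a _ => by simp; omega
  simpa using h

-- A fold traverses only one list, so the unread part of the second list belongs to the state; once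
-- it is empty, the state no longer changes.
omit [TreeRep α] [TreeRep β] in
theorem zip_foldl (l : List α) (m : List β) (out : List (α × β)) :
    (l.foldl (fun (s : List β × List (α × β)) a =>
      match s.1 with
      | [] => s
      | b :: m => (m, (a, b) :: s.2)) (m, out)).2 = (l.zip m).reverse ++ out := by
  induction l generalizing m out with
  | nil => simp
  | cons a l ih =>
    cases m with
    | nil =>
      have := ih [] out
      simpa using this
    | cons b m => simp [ih]

theorem PT.zip {l : γ → List α} {m : γ → List β} (hl : PT l) (hm : PT m) :
    PT fun x => (l x).zip (m x) := by
  have h : PT fun x => (l x).foldl (fun (s : List β × List (α × β)) a =>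
      match s.1 with
      | [] => s
      | b :: m => (m, (a, b) :: s.2)) (m x, []) := by
    refine PT.foldl_add hl (hm.pair (PT.const [])) ?_ (Polynomial.X + 1) fun x b a _ => ?_
    · refine PT.list_cases (l := fun x : γ × (List β × List (α × β)) × α => x.2.1.1)
        (g := fun x b m => (m, (x.2.2, b) :: x.2.1.2)) PT.snd'.fst.fst PT.snd'.fst
        (PT.fst'.snd.pair (PT.cons (PT.snd'.snd.snd.pair PT.fst'.fst) PT.snd'.snd.fst.snd))
        (fun x hx => ?_) fun x b m hx => ?_
      · simp only [hx]
      · simp only [hx]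
    · rcases b with ⟨_ | ⟨b, m⟩, out⟩ <;> simp <;> omega
  simpa [zip_foldl] using h.snd.reverse

/-! ### Decisions -/

theorem PT.and {f g : γ → Bool} (hf : PT f) (hg : PT g) : PT fun x => f x && g x := by
  convert hf.cond hg (PT.const false) using 2 with x
  cases f x <;> rfl

theorem PT.or {f g : γ → Bool} (hf : PT f) (hg : PT g) : PT fun x => f x || g x := by
  convert hf.cond (PT.const true) hg using 2 with x
  cases f x <;> rfl

theorem PT.not {f : γ → Bool} (hf : PT f) : PT fun x => !f x := by
  convert hf.cond (PT.const false) (PT.const true) using 2 with x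
  cases f x <;> rfl

theorem PT.bxor {f g : γ → Bool} (hf : PT f) (hg : PT g) : PT fun x => xor (f x) (g x) := by
  convert hf.cond (hg.cond (PT.const false) (PT.const true)) hg using 2 with x
  cases f x <;> cases g x <;> rfl

/-! ### Natural numbers -/

theorem sz_bool (b : Bool) : sz b = bif b then 3 else 1 := by cases b <;> rfl

theorem sz_bits (l : List Bool) : 2 * l.length + 1 ≤ sz l ∧ sz l ≤ 4 * l.length + 1 := by
  induction l with
  | nil => simp
  | cons b l ih => cases b <;> simp [sz_bool] <;> omega

/-- Tree size and bit length agree up to a constant factor. Folds over numbers are measured by bit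
length, which is subadditive under sums and products; the tree size also depends on the values of
the bits. -/
theorem size_le_sz (n : ℕ) : 2 * n.size + 1 ≤ sz n := by
  have := (sz_bits n.bits).1
  rwa [Nat.size_eq_bits_len] at this

theorem sz_le_size (n : ℕ) : sz n ≤ 4 * n.size + 1 := by
  have := (sz_bits n.bits).2
  rwa [Nat.size_eq_bits_len] at this

theorem size_add_le (a b : ℕ) : (a + b).size ≤ a.size + b.size := by
  rw [Nat.size_le, pow_add]
  have ha := Nat.lt_size_self a
  have hb := Nat.lt_size_self b
  rcases Nat.eq_zero_or_pos a with rfl | h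
  · simpa using hb
  rcases Nat.eq_zero_or_pos b with rfl | h'
  · simpa using ha
  nlinarith

theorem size_mul_le (a b : ℕ) : (a * b).size ≤ a.size + b.size := by
  rw [Nat.size_le, pow_add]
  exact Nat.mul_lt_mul'' (Nat.lt_size_self a) (Nat.lt_size_self b)

theorem PT.bits {f : γ → ℕ} (hf : PT f) : PT fun x => (f x).bits := hf.congr_rep fun _ => rfl

theorem PT.bodd {f : γ → ℕ} (hf : PT f) : PT fun x => (f x).bodd := by
  convert hf.bits.headD (PT.const false) using 2 with x
  induction f x using Nat.binaryRec' with
  | zero => rfl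
  | bit b n h _ => simp [Nat.bits_append_bit _ _ h]

theorem PT.div2 {f : γ → ℕ} (hf : PT f) : PT fun x => (f x).div2 :=
  hf.bits.tail.congr_rep fun x => by rw [← Nat.div2_bits_eq_tail]; rfl

theorem PT.bit {b : γ → Bool} {f : γ → ℕ} (hb : PT b) (hf : PT f) :
    PT fun x => Nat.bit (b x) (f x) := by
  -- A bit list must not end in `false`: prepending the bit 0 to the number 0 has to leave the empty
  -- list.
  have h : PT fun x => bif (b x) then true :: (f x).bits else
      bif (f x).bits.isEmpty then [] else false :: (f x).bits :=
    hb.cond (PT.cons (PT.const true) hf.bits)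
      (hf.bits.isEmpty.cond (PT.const []) (PT.cons (PT.const false) hf.bits))
  refine h.congr_rep fun x => ?_
  show _ = rep (Nat.bit (b x) (f x)).bits
  congr 1
  cases b x
  · rcases Nat.eq_zero_or_pos (f x) with h | h
    · simp [h]
    · rw [Nat.bits_append_bit _ _ (by omega)]
      have : (f x).bits.isEmpty = false := by
        rw [List.isEmpty_eq_false_iff, ← List.length_pos_iff, Nat.size_eq_bits_len]
        exact Nat.size_pos.2 h
      simp [this]
  · rw [Nat.bits_append_bit _ _ (by simp)]
    rfl

theorem size_bit_le (b : Bool) (n : ℕ) : (Nat.bit b n).size ≤ n.size + 1 := by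
  by_cases h : Nat.bit b n = 0
  · simp [h]
  · rw [Nat.size_bit h]

/-- The number whose bits are given, the most significant one first. -/
def ofBits (l : List Bool) : ℕ := l.foldl (fun n b => Nat.bit b n) 0

theorem PT.ofBits {l : γ → List Bool} (hl : PT l) : PT fun x => ofBits (l x) :=
  PT.foldl_measure hl (PT.const 0) (PT.bit PT.snd'.snd PT.snd'.fst) Nat.size
    (fun n => by have := size_le_sz n; omega) (fun n => by have := sz_le_size n; omega) 1
    fun x b a _ => by simpa using size_bit_le a b

theorem foldl_bit (l : List Bool) (n : ℕ) :
    l.foldl (fun n b => Nat.bit b n) n = n * 2 ^ l.length + ofBits l := by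
  induction l generalizing n with
  | nil => simp [ofBits]
  | cons b l ih =>
    simp only [ofBits, List.foldl_cons, List.length_cons] at *
    rw [ih, ih (Nat.bit b 0)]
    simp only [Nat.bit_val]
    ring

theorem ofBits_cons (b : Bool) (l : List Bool) :
    ofBits (b :: l) = b.toNat * 2 ^ l.length + ofBits l := by
  rw [ofBits, List.foldl_cons, foldl_bit, Nat.bit_val]
  simp

theorem ofBits_lt (l : List Bool) : ofBits l < 2 ^ l.length := by
  induction l with
  | nil => simp [ofBits]
  | cons b l ih =>
    rw [ofBits_cons, List.length_cons, pow_succ]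
    cases b <;> simp <;> omega

theorem ofBits_reverse_bits (n : ℕ) : ofBits n.bits.reverse = n := by
  rw [ofBits, List.foldl_reverse]
  induction n using Nat.binaryRec' with
  | zero => rfl
  | bit b n h ih => rw [Nat.bits_append_bit _ _ h, List.foldr_cons, ih]

/-! ### Addition, subtraction and comparison of binary numbers -/

/-- The majority of three bits. -/
def maj (a b c : Bool) : Bool := bif a then b || c else b && c

/-- A step of the addition (for `s = false`) or of the subtraction (for `s = true`) of two binary
numbers: the state consists of the numbers, the carry, and the bits of the result. -/
def ripple (s : Bool) (x : (ℕ × ℕ) × (Bool × List Bool)) : (ℕ × ℕ) × (Bool × List Bool) :=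
  ((x.1.1.div2, x.1.2.div2), (maj (xor s x.1.1.bodd) x.1.2.bodd x.2.1,
    xor x.1.1.bodd (xor x.1.2.bodd x.2.1) :: x.2.2))

/-- The result of the addition or subtraction. -/
def rippleAll (s : Bool) (a b : ℕ) : (ℕ × ℕ) × (Bool × List Bool) :=
  (a.bits ++ b.bits ++ [true]).foldl (fun x _ => ripple s x) ((a, b), (false, []))

theorem PT.maj {a b c : γ → Bool} (ha : PT a) (hb : PT b) (hc : PT c) :
    PT fun x => maj (a x) (b x) (c x) := by
  refine ha.cond ?_ ?_
  · convert hb.cond (PT.const true) hc using 2 with x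
    cases b x <;> rfl
  · convert hb.cond hc (PT.const false) using 2 with x
    cases b x <;> rfl

theorem PT.ripple (s : Bool) : PT (ripple s) :=
  PT.pair (PT.pair PT.fst'.fst.div2 PT.fst'.snd.div2)
    (PT.pair (PT.maj ((PT.const s).bxor PT.fst'.fst.bodd) PT.fst'.snd.bodd PT.snd'.fst)
      (PT.cons (PT.fst'.fst.bodd.bxor (PT.fst'.snd.bodd.bxor PT.snd'.fst)) PT.snd'.snd))

theorem sz_div2_le (n : ℕ) : sz n.div2 ≤ sz n := by
  show sz n.div2.bits ≤ sz n.bits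
  rw [Nat.div2_bits_eq_tail]
  cases n.bits <;> simp
  omega

theorem PT.rippleAll {f g : γ → ℕ} (s : Bool) (hf : PT f) (hg : PT g) :
    PT fun x => rippleAll s (f x) (g x) := by
  refine PT.foldl_add (PT.append (hf.bits.append hg.bits) (PT.const [true]))
    ((hf.pair hg).pair (PT.const (false, []))) ((PT.ripple s).comp PT.snd'.fst) 6 fun x b a _ => ?_
  obtain ⟨⟨m, n⟩, c, l⟩ := b
  have h1 := sz_div2_le m
  have h2 := sz_div2_le n
  simp only [ProxyRank.ripple, sz_pair, sz_cons, sz_bool, Polynomial.eval_ofNat]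
  generalize ProxyRank.maj _ _ _ = b1
  generalize xor _ _ = b2
  cases b1 <;> cases b2 <;> cases c <;> simp <;> omega

/-- The loop invariant of addition: the digits found so far, plus the unread parts and the carry
shifted by the number of these digits, always give the same value. New digits are prepended, so the
list has its most significant digit first, as `ofBits` expects. -/
theorem ripple_add (x : (ℕ × ℕ) × (Bool × List Bool)) :
    ofBits (ripple false x).2.2 + 2 ^ (ripple false x).2.2.length *
        ((ripple false x).1.1 + (ripple false x).1.2 + (ripple false x).2.1.toNat) =
      ofBits x.2.2 + 2 ^ x.2.2.length * (x.1.1 + x.1.2 + x.2.1.toNat) := by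
  obtain ⟨⟨m, n⟩, c, l⟩ := x
  have h1 := Nat.bodd_add_div2 m
  have h2 := Nat.bodd_add_div2 n
  simp only [ripple, ofBits_cons, List.length_cons]
  conv_rhs => rw [← h1, ← h2]
  cases m.bodd <;> cases n.bodd <;> cases c <;> simp [maj] <;> ring

/-- The corresponding invariant for subtraction, over the integers: the majority with the first bit
negated is the borrow. -/
theorem ripple_sub (x : (ℕ × ℕ) × (Bool × List Bool)) :
    (ofBits (ripple true x).2.2 : ℤ) + 2 ^ (ripple true x).2.2.length *
        ((ripple true x).1.1 - (ripple true x).1.2 - (ripple true x).2.1.toNat) =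
      ofBits x.2.2 + 2 ^ x.2.2.length * (x.1.1 - x.1.2 - x.2.1.toNat) := by
  obtain ⟨⟨m, n⟩, c, l⟩ := x
  have h1 := Nat.bodd_add_div2 m
  have h2 := Nat.bodd_add_div2 n
  simp only [ripple, ofBits_cons, List.length_cons]
  conv_rhs => rw [← h1, ← h2]
  cases m.bodd <;> cases n.bodd <;> cases c <;> simp [maj] <;> ring

theorem ripple_iterate (s : Bool) (x : (ℕ × ℕ) × (Bool × List Bool)) (m : ℕ) :
    ((ripple s)^[m] x).1 = (x.1.1 / 2 ^ m, x.1.2 / 2 ^ m) ∧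
      ((ripple s)^[m] x).2.2.length = x.2.2.length + m := by
  induction m with
  | zero => simp
  | succ m ih =>
    simp only [Function.iterate_succ_apply', ripple, ih, Nat.div2_val, pow_succ, Nat.div_div_eq_div_mul,
      List.length_cons]
    exact ⟨trivial, by omega⟩

/-- The list that is folded over is only a clock: its entries are ignored, and its length is large
enough to exhaust both numbers and to hold all digits of the sum. -/
theorem rippleAll_eq (s : Bool) (a b : ℕ) :
    rippleAll s a b = (ripple s)^[a.size + b.size + 1] ((a, b), (false, [])) := by
  rw [rippleAll, List.foldl_const]
  congr 2
  simp [Nat.size_eq_bits_len, add_assoc]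

theorem rippleAll_fst (s : Bool) (a b : ℕ) : (rippleAll s a b).1 = (0, 0) := by
  rw [rippleAll_eq, (ripple_iterate _ _ _).1]
  have ha := Nat.lt_size_self a
  have hb := Nat.lt_size_self b
  have ha' := Nat.pow_le_pow_right (n := 2) (by omega) (by omega : a.size ≤ a.size + b.size + 1)
  have hb' := Nat.pow_le_pow_right (n := 2) (by omega) (by omega : b.size ≤ a.size + b.size + 1)
  rw [Nat.div_eq_of_lt (ha.trans_le ha'), Nat.div_eq_of_lt (hb.trans_le hb')]

theorem ofBits_rippleAll_false (a b : ℕ) : ofBits (rippleAll false a b).2.2 = a + b := by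
  have h (m : ℕ) (x : (ℕ × ℕ) × (Bool × List Bool)) :
      ofBits ((ripple false)^[m] x).2.2 + 2 ^ ((ripple false)^[m] x).2.2.length *
        (((ripple false)^[m] x).1.1 + ((ripple false)^[m] x).1.2 +
          ((ripple false)^[m] x).2.1.toNat) =
      ofBits x.2.2 + 2 ^ x.2.2.length * (x.1.1 + x.1.2 + x.2.1.toNat) := by
    induction m with
    | zero => rfl
    | succ m ih => rw [Function.iterate_succ_apply', ripple_add, ih]
  have h1 := h (a.size + b.size + 1) ((a, b), (false, []))
  have h2 := (ripple_iterate false ((a, b), (false, [])) (a.size + b.size + 1)).2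
  have h3 := rippleAll_fst false a b
  rw [← rippleAll_eq] at h1 h2
  rw [h3, h2] at h1
  have ha := Nat.lt_size_self a
  have hb := Nat.lt_size_self b
  have hs : a + b < 2 ^ (a.size + b.size + 1) := by
    have := Nat.lt_size_self (a + b)
    exact this.trans_le (Nat.pow_le_pow_right (by omega) ((size_add_le a b).trans (by omega)))
  simp [ofBits] at h1 hs ⊢
  -- A remaining carry would contribute `2 ^ (a.size + b.size + 1)`, which exceeds `a + b`.
  cases h : (rippleAll false a b).2.1
  · simpa [h] using h1
  · simp [h] at h1; omega

/-- With N digits the invariant ends as: digits - 2^N * borrow = a - b. As the digits denote a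
number in [0, 2^N), the borrow is set exactly if a < b. -/
theorem rippleAll_true (a b : ℕ) :
    (rippleAll true a b).2.1 = decide (a < b) ∧
      (b ≤ a → ofBits (rippleAll true a b).2.2 = a - b) := by
  have h (m : ℕ) (x : (ℕ × ℕ) × (Bool × List Bool)) :
      (ofBits ((ripple true)^[m] x).2.2 : ℤ) + 2 ^ ((ripple true)^[m] x).2.2.length *
        (((ripple true)^[m] x).1.1 - ((ripple true)^[m] x).1.2 -
          ((ripple true)^[m] x).2.1.toNat) =
      ofBits x.2.2 + 2 ^ x.2.2.length * (x.1.1 - x.1.2 - x.2.1.toNat) := by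
    induction m with
    | zero => rfl
    | succ m ih => rw [Function.iterate_succ_apply', ripple_sub, ih]
  have h1 := h (a.size + b.size + 1) ((a, b), (false, []))
  have h2 := (ripple_iterate true ((a, b), (false, [])) (a.size + b.size + 1)).2
  have h3 := rippleAll_fst true a b
  rw [← rippleAll_eq] at h1 h2
  have h4 := ofBits_lt (rippleAll true a b).2.2
  rw [h3, h2] at h1
  rw [h2] at h4
  zify at h4
  cases h : (rippleAll true a b).2.1
  · simp [h, ofBits] at h1 h4 ⊢
    omega
  · simp [h, ofBits] at h1 h4 ⊢
    omega

theorem PT.add {f g : γ → ℕ} (hf : PT f) (hg : PT g) : PT fun x => f x + g x := by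
  simpa [ofBits_rippleAll_false] using (PT.rippleAll false hf hg).snd.snd.ofBits

theorem PT.lt {f g : γ → ℕ} (hf : PT f) (hg : PT g) : PT fun x => decide (f x < g x) := by
  simpa [rippleAll_true] using (PT.rippleAll true hf hg).snd.fst

theorem PT.sub {f g : γ → ℕ} (hf : PT f) (hg : PT g) : PT fun x => f x - g x := by
  have := (hf.lt hg).cond (PT.const 0) (PT.rippleAll true hf hg).snd.snd.ofBits
  convert this using 2 with x
  by_cases h : f x < g x
  · simp [h]; omega
  · simp [h, (rippleAll_true _ _).2 (not_lt.1 h)]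

theorem PT.le {f g : γ → ℕ} (hf : PT f) (hg : PT g) : PT fun x => decide (f x ≤ g x) := by
  convert (hg.lt hf).not using 2 with x
  simp [← decide_not]

theorem PT.eq {f g : γ → ℕ} (hf : PT f) (hg : PT g) : PT fun x => decide (f x = g x) := by
  convert (hf.le hg).and (hg.le hf) using 2 with x
  simp [← Bool.decide_and, le_antisymm_iff]

/-! ### Products, sums over lists, and ranges -/

/-- Horner's scheme on the binary digits of `a`, the most significant one first. -/
theorem mul_eq_foldl (a b : ℕ) : a * b = a.bits.reverse.foldl
    (fun n c => bif c then Nat.bit false n + b else Nat.bit false n) 0 := by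
  rw [List.foldl_reverse]
  induction a using Nat.binaryRec' with
  | zero => simp
  | bit c a h ih =>
    rw [Nat.bits_append_bit _ _ h, List.foldr_cons, ← ih]
    cases c <;> simp [Nat.bit_val] <;> ring

theorem PT.mul {f g : γ → ℕ} (hf : PT f) (hg : PT g) : PT fun x => f x * g x := by
  simp only [mul_eq_foldl]
  obtain ⟨p, hp⟩ := hg.sz_le
  refine PT.foldl_measure hf.bits.reverse (PT.const 0)
    (PT.cond PT.snd'.snd (PT.add (PT.bit (PT.const false) PT.snd'.fst) (hg.comp PT.fst'))
      (PT.bit (PT.const false) PT.snd'.fst)) Nat.size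
    (fun n => by have := size_le_sz n; omega) (fun n => by have := sz_le_size n; omega)
    (p + 1) fun x n c _ => ?_
  have h1 := size_add_le (Nat.bit false n) (g x)
  have h2 := size_bit_le false n
  have h3 := size_le_sz (g x)
  have h4 := hp x
  have h5 : p.eval (sz x) ≤ p.eval (sz x + sz c) := monotone_eval p (Nat.le_add_right _ _)
  simp only [Polynomial.eval_add, Polynomial.eval_one]
  cases c <;> simp only [cond_true, cond_false] <;> omega

theorem PT.sum {l : γ → List α} {g : γ → α → ℕ} (hl : PT l)
    (hg : PT fun x : γ × α => g x.1 x.2) : PT fun x => ((l x).map (g x)).sum := by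
  obtain ⟨p, hp⟩ := hg.sz_le
  have hg' : PT fun x : γ × ℕ × α => g x.1 x.2.2 :=
    hg.comp (g := fun x : γ × ℕ × α => (x.1, x.2.2)) (PT.fst'.pair PT.snd'.snd)
  have h : PT fun x => (l x).foldl (fun n a => n + g x a) 0 := by
    refine PT.foldl_measure hl (PT.const 0) (PT.add PT.snd'.fst hg')
      Nat.size (fun n => by have := size_le_sz n; omega)
      (fun n => by have := sz_le_size n; omega) (p.comp (Polynomial.X + 1)) fun x n a _ => ?_
    have h1 := size_add_le n (g x a)
    have h3 := size_le_sz (g x a)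
    have h4 := hp (x, a)
    simp at *; omega
  convert h using 2 with x
  rw [List.sum_eq_foldl, List.foldl_map]

/-- The bit length of a product is at most the sum of the bit lengths, so even long products stay
polynomially small. -/
theorem PT.prod {l : γ → List α} {g : γ → α → ℕ} (hl : PT l)
    (hg : PT fun x : γ × α => g x.1 x.2) : PT fun x => ((l x).map (g x)).prod := by
  obtain ⟨p, hp⟩ := hg.sz_le
  have hg' : PT fun x : γ × ℕ × α => g x.1 x.2.2 :=
    hg.comp (g := fun x : γ × ℕ × α => (x.1, x.2.2)) (PT.fst'.pair PT.snd'.snd)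
  have h : PT fun x => (l x).foldl (fun n a => n * g x a) 1 := by
    refine PT.foldl_measure hl (PT.const 1) (PT.mul PT.snd'.fst hg')
      Nat.size (fun n => by have := size_le_sz n; omega)
      (fun n => by have := sz_le_size n; omega) (p.comp (Polynomial.X + 1)) fun x n a _ => ?_
    have h1 := size_mul_le n (g x a)
    have h3 := size_le_sz (g x a)
    have h4 := hp (x, a)
    simp at *; omega
  convert h using 2 with x
  rw [List.prod_eq_foldl, List.foldl_map]

omit [TreeRep α] in
theorem range_foldl (l : List α) :
    l.foldl (fun (s : ℕ × List ℕ) _ => (s.1 + 1, s.1 :: s.2)) (0, []) =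
      (l.length, (List.range l.length).reverse) := by
  rw [List.foldl_const]
  induction l.length with
  | zero => rfl
  | succ n ih => rw [Function.iterate_succ_apply', ih]; simp [List.range_succ]

/-- The bound of the range is given as the length of a list, that is, in unary; a range up to a
binary number could be exponentially long. The n entries have size at most 4n + 1 each, whence a
quadratic bound. -/
theorem PT.range {l : γ → List α} (hl : PT l) : PT fun x => List.range (l x).length := by
  obtain ⟨p, hp⟩ := hl.sz_le
  have h : PT fun x => (l x).foldl (fun (s : ℕ × List ℕ) _ => (s.1 + 1, s.1 :: s.2)) (0, []) := by
    refine PT.foldl hl (PT.const (0, [])) (PT.pair (PT.snd'.fst.fst.add (PT.const 1))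
      (PT.cons PT.snd'.fst.fst PT.snd'.fst.snd)) ((4 * p + 2) * (p + 1) + 1) fun x l₁ hl₁ => ?_
    rw [range_foldl]
    have h1 : l₁.length ≤ p.eval (sz x) := hl₁.length_le.trans ((length_le_sz _).trans (hp x))
    have h2 (n : ℕ) : sz n ≤ 4 * n + 1 := by
      have h3 : n.size ≤ n := Nat.size_le.2 Nat.lt_two_pow_self
      have := sz_le_size n
      omega
    have h4 (n : ℕ) : sz (List.range n).reverse ≤ (4 * n + 2) * n + 1 := by
      induction n with
      | zero => simp
      | succ n ih =>
        rw [List.range_succ, List.reverse_append]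
        have := h2 n
        simp only [List.reverse_singleton, List.singleton_append, sz_cons]
        nlinarith
    have h5 := h2 l₁.length
    have h6 := h4 l₁.length
    simp only [sz_pair, Polynomial.eval_add, Polynomial.eval_mul, Polynomial.eval_ofNat,
      Polynomial.eval_one]
    nlinarith
  simpa [range_foldl] using h.snd.reverse

end ProxyRank

namespace ProxyRank

open Turing Computability
open ProxyRank.TreeRep (rep)

/-! ### From words to trees and back -/

/-- Symbols are triples of Booleans, so they can be examined by projections. The symbols `ket` and
`blank` share a tree, which does no harm since the parser ignores both. -/
instance : TreeRep Sym := ⟨fun s =>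
  match s with
  | .bit b => rep (true, (b, true))
  | .comma => rep (false, (true, true))
  | .bra => rep (false, (true, false))
  | _ => rep (false, (false, false))⟩

/-- The three trees are chosen so that popping symbols one by one soon tells them apart: the words
are `comma`, `bra comma comma` and `bra comma bra comma comma`. -/
instance : TreeRep (Option Bool) := ⟨fun o =>
  match o with
  | none => .nil
  | some false => .cons .nil .nil
  | some true => .cons .nil (.cons .nil .nil)⟩

/-- The output symbol given by an optional bit. -/
def outSym : Option Bool → Sym
  | none => .comma
  | some b => .bit b

open TM2.Stmt in
/-- Case distinction according to the symbol in the buffer. -/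
def onSym {L : Type} (q : Sym → Code L) : Code L :=
  branch (fun v => decide (v = some Γ'.blank)) (q .blank) <|
  branch (fun v => decide (v = some (Γ'.bit true))) (q (.bit true)) <|
  branch (fun v => decide (v = some (Γ'.bit false))) (q (.bit false)) <|
  branch (fun v => decide (v = some Γ'.bra)) (q .bra) <|
  branch (fun v => decide (v = some Γ'.ket)) (q .ket) (q .comma)

@[simp] theorem stepAux_onSym {L : Type} (q : Sym → Code L) (s : Sym) (S : Fin 4 → List Sym) :
    TM2.stepAux (onSym q) (some s) S = TM2.stepAux (q s) (some s) S := by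
  rcases s with _ | ⟨_ | _⟩ | _ | _ | _ <;> rfl

/-- Code that pushes a word on stack `0`. -/
def pushWord {L : Type} : List Sym → Code L → Code L
  | [], q => q
  | s :: w, q => pushWord w (TM2.Stmt.push 0 (fun _ => s) q)

@[simp] theorem stepAux_pushWord {L : Type} (w : List Sym) (q : Code L) (v : Option Sym)
    (a b c d : List Sym) : TM2.stepAux (pushWord w q) v (st a b c d) =
      TM2.stepAux q v (st (w ++ a) b c d) := by
  induction w generalizing q with
  | nil => rfl
  | cons s w ih => simp [pushWord, ih]

open TM2.Stmt in
/-- Code that turns an input word into a tree. -/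
def readWord : Frag := (moveAll 0 1).seq <| (push₀ Γ'.comma).seq <| Frag.loop 1 nonempty <|
  Frag.op fun _ q => pop 1 (fun _ s => s) <|
    onSym fun s => pushWord (Γ'.bra :: (rep s).enc) <| load (fun _ => none) q

/-- The tree of a list is built from its last entry on. Moving the word to stack 1 puts the last
symbol on top, and each further symbol prepends one list cell in a single step. -/
theorem runs_readWord (w : List Sym) :
    readWord.Runs (st₀ w) (4 * w.length + 3) (st₀ (rep w).enc) := by
  have h (l w : List Sym) : (Frag.loop 1 nonempty <| Frag.op fun _ q =>
      TM2.Stmt.pop 1 (fun _ s => s) <| onSym fun s => pushWord (Γ'.bra :: (rep s).enc) <|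
        TM2.Stmt.load (fun _ => none) q).Runs (st (rep w).enc l [] []) (2 * l.length + 1)
          (st₀ (rep (l.reverse ++ w)).enc) := by
    induction l generalizing w with
    | nil => exact Frag.runs_loop_stop rfl
    | cons s l ih =>
      have := Frag.Runs.loop_step (k := 1) (p := nonempty) (S := st (rep w).enc (s :: l) [] [])
        (S' := st (rep (s :: w)).enc l [] []) rfl
        (Frag.runs_op fun L z => by simp [rep, Tr.enc]) (ih (s :: w))
      simpa using this.mono (t := 2 * (l.length + 1) + 1) (by omega)
  have h' := (runs_moveAll_zero_one w [] [] []).seq ((Frag.runs_op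
    (c := fun _ q => TM2.Stmt.push 0 (fun _ => Γ'.comma) q) (S' := st (rep ([] : List Sym)).enc
    (w.reverse ++ []) [] []) fun L z => by simp [rep, Tr.enc]).seq (h _ _))
  simpa [readWord, push₀] using h'.mono (t := 4 * w.length + 3) (by simp; omega)

open TM2.Stmt in
/-- Code that turns a tree into an output word. -/
def writeWord : Frag := (Frag.loop 0 isBra <| Frag.op fun _ q =>
    pop 0 (fun _ _ => none) <| pop 0 (fun _ s => s) <| onSym fun s =>
      if s = Γ'.comma then push 1 (fun _ => Γ'.comma) <| load (fun _ => none) q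
      else pop 0 (fun _ s => s) <| pop 0 (fun _ s => s) <| onSym fun s =>
        if s = Γ'.comma then push 1 (fun _ => Γ'.bit false) <| load (fun _ => none) q
        else pop 0 (fun _ s => s) <| pop 0 (fun _ _ => none) <| push 1 (fun _ => Γ'.bit true) q).seq
  (pop₀.seq (moveAll 1 0))

theorem runs_writeWord (l : List (Option Bool)) :
    writeWord.Runs (st₀ (rep l).enc) (4 * l.length + 3) (st₀ (l.map outSym)) := by
  have h (l : List (Option Bool)) (w : List Sym) : (Frag.loop 0 isBra <| Frag.op fun _ q =>
    TM2.Stmt.pop 0 (fun _ _ => none) <| TM2.Stmt.pop 0 (fun _ s => s) <| onSym fun s =>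
      if s = Γ'.comma then TM2.Stmt.push 1 (fun _ => Γ'.comma) <| TM2.Stmt.load (fun _ => none) q
      else TM2.Stmt.pop 0 (fun _ s => s) <| TM2.Stmt.pop 0 (fun _ s => s) <| onSym fun s =>
        if s = Γ'.comma then TM2.Stmt.push 1 (fun _ => Γ'.bit false) <|
          TM2.Stmt.load (fun _ => none) q
        else TM2.Stmt.pop 0 (fun _ s => s) <| TM2.Stmt.pop 0 (fun _ _ => none) <|
          TM2.Stmt.push 1 (fun _ => Γ'.bit true) q).Runs (st (rep l).enc w [] [])
            (2 * l.length + 1) (st [Γ'.comma] ((l.map outSym).reverse ++ w) [] []) := by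
    induction l generalizing w with
    | nil => exact Frag.runs_loop_stop rfl
    | cons o l ih =>
      have := Frag.Runs.loop_step (k := 0) (p := isBra) (S := st (rep (o :: l)).enc w [] [])
        (S' := st (rep l).enc (outSym o :: w) [] []) rfl
        (Frag.runs_op fun L z => by
          rcases o with _ | ⟨_ | _⟩ <;> simp [rep, Tr.enc, outSym]) (ih (outSym o :: w))
      simpa using this.mono (t := 2 * (l.length + 1) + 1) (by omega)
  have h' := (h l []).seq ((Frag.runs_op (c := fun _ q => TM2.Stmt.pop 0 (fun _ _ => none) q)
    (S' := st [] ((l.map outSym).reverse ++ []) [] [])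
    fun L z => by simp).seq (runs_moveAll_one_zero _ _ _ _))
  simpa [writeWord, pop₀] using h'.mono (t := 4 * l.length + 3) (by simp; omega)

/-! ### From program fragments to Turing machines -/

/-- The machine that executes a program fragment. -/
def Frag.machine (F : Frag) : FinTM2 where
  K := Fin 4
  k₀ := 0
  k₁ := 0
  Γ := fun _ => Sym
  Λ := Option F.Lab
  main := some F.start
  ΛFin := letI := F.fin; inferInstance
  σ := Option Sym
  initialState := none
  m
    | none => TM2.Stmt.halt
    | some l => F.code _ some none l

/-- The machine has one label more than the fragment; it serves as the exit and halts, which costs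
the additional step in `p + 1`. -/
theorem polyTime_of_runs {α β : Type} {ea : α → List Sym} {eb : β → List Sym} {g : α → β}
    (F : Frag) (p : Polynomial ℕ)
    (h : ∀ x, F.Runs (st₀ (ea x)) (p.eval (ea x).length) (st₀ (eb (g x)))) : PolyTime ea eb g := by
  refine ⟨⟨F.machine, Equiv.refl _, Equiv.refl _⟩, p + 1,
    fun x => Classical.choice ?_⟩
  obtain ⟨n, hn, hr⟩ := (h x _ some none F.machine.m fun _ => rfl).trans
    (Within.step (M := F.machine.m) (l := none) (S := st₀ (eb (g x)))
      (c' := ⟨none, none, st₀ (eb (g x))⟩) rfl)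
  have h0 : initList F.machine (ea x) = ⟨some (some F.start), none, st₀ (ea x)⟩ := by
    unfold initList
    congr 1
    funext (k : Fin 4)
    match k with
    | 0 => rfl
    | 1 => rfl
    | 2 => rfl
    | 3 => rfl
  have h1 : haltList F.machine (eb (g x)) = ⟨none, none, st₀ (eb (g x))⟩ := by
    unfold haltList
    congr 1
    funext (k : Fin 4)
    match k with
    | 0 => rfl
    | 1 => rfl
    | 2 => rfl
    | 3 => rfl
  refine ⟨⟨⟨n, ?_⟩, by simpa using hn⟩⟩
  have e0 : (ea x).map (Equiv.refl Sym).invFun = ea x := List.map_id _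
  have e1 : (eb (g x)).map (Equiv.refl Sym).invFun = eb (g x) := List.map_id _
  erw [e0, e1, h0]
  refine Eq.trans hr ?_
  exact congrArg some h1.symm

theorem sz_word_le (w : List Sym) : sz w ≤ 12 * w.length + 1 := by
  induction w with
  | nil => simp
  | cons s w ih =>
    -- Three bits of size at most 3 and two pairing nodes; the list cell then adds one.
    have : sz s ≤ 11 := by rcases s with _ | ⟨_ | _⟩ | _ | _ | _ <;> decide
    simp; omega

/-- A function is computed by a Turing machine in polynomial time if a corresponding function of
the words that encode its arguments is computed in polynomial time with respect to trees. -/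
theorem PT.polyTime {α β : Type} {ea : α → List Sym} {eb : β → List Sym} {g : α → β}
    {f : List Sym → List (Option Bool)} (hf : PT f)
    (h : ∀ x, (f (ea x)).map outSym = eb (g x)) : PolyTime ea eb g := by
  obtain ⟨F, p, hF⟩ := hf
  refine polyTime_of_runs (readWord.seq (F.seq writeWord))
    (4 * Polynomial.X + 5 * p.comp (12 * Polynomial.X + 1) + 6) fun x => ?_
  have h1 := ((hF (ea x)).1 [])
  simp only [List.append_nil] at h1
  rw [← h]
  refine ((runs_readWord (ea x)).seq (h1.seq (runs_writeWord _))).mono ?_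
  have h2 := (length_le_sz _).trans (hF (ea x)).2
  have h3 := monotone_eval p (sz_word_le (ea x))
  simp at *; omega

end ProxyRank

namespace ProxyRank

/-! ### The matrix of partial derivatives in coordinates -/

/-- Differentiation produces the factor α_i + 1, which turns the product of the factorials of α into
that of α + e_i. -/
theorem scaledCoeff_pderiv {n : ℕ} (f : MvPolynomial (Fin n) ℝ) (i : Fin n) (α : Fin n →₀ ℕ) :
    scaledCoeff (MvPolynomial.pderiv i f) α = scaledCoeff f (α + Finsupp.single i 1) := by
  rw [scaledCoeff, scaledCoeff, MvPolynomial.coeff_pderiv, mul_assoc]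
  congr 1
  have h1 := Finset.mul_prod_erase _ (fun j => ((α j)! : ℝ)) (Finset.mem_univ i)
  have h2 := Finset.mul_prod_erase _ (fun j => (((α + Finsupp.single i 1 : Fin n →₀ ℕ) j)! : ℝ))
    (Finset.mem_univ i)
  have h : ∏ j ∈ Finset.univ.erase i, (((α + Finsupp.single i 1 : Fin n →₀ ℕ) j)! : ℝ) =
      ∏ j ∈ Finset.univ.erase i, ((α j)! : ℝ) :=
    Finset.prod_congr rfl fun j hj => by
      simp [(Finset.ne_of_mem_erase hj).symm]
  rw [← h1, ← h2, h]
  simp [Nat.factorial_succ]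
  ring

theorem scaledCoeff_pderiv_iterate {n : ℕ} (f : MvPolynomial (Fin n) ℝ) (i : Fin n) (m : ℕ)
    (α : Fin n →₀ ℕ) : scaledCoeff ((MvPolynomial.pderiv i)^[m] f) α =
      scaledCoeff f (α + Finsupp.single i m) := by
  induction m generalizing α with
  | zero => simp
  | succ m ih =>
    rw [Function.iterate_succ_apply', scaledCoeff_pderiv, ih, add_assoc, ← Finsupp.single_add,
      add_comm 1 m]

/-- The coordinates of a partial derivative in the scaled monomial basis. -/
theorem scaledCoeff_partialDeriv {n : ℕ} (β : Fin n → ℕ) (f : MvPolynomial (Fin n) ℝ)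
    (α : Fin n →₀ ℕ) : scaledCoeff (partialDeriv β f) α =
      scaledCoeff f (α + Finsupp.equivFunOnFinite.symm β) := by
  have h (l : List (Fin n)) (α : Fin n →₀ ℕ) :
      scaledCoeff (l.foldr (fun i g => (MvPolynomial.pderiv i)^[β i] g) f) α =
        scaledCoeff f (α + (l.map fun i => Finsupp.single i (β i)).sum) := by
    induction l generalizing α with
    | nil => simp
    | cons i l ih => rw [List.foldr_cons, scaledCoeff_pderiv_iterate, ih]; simp [add_assoc]
  rw [partialDeriv, h]
  congr 2
  rw [← List.sum_toFinset _ (List.nodup_finRange n), List.toFinset_finRange]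
  ext i
  simp [Finsupp.finsetSum_apply, Finsupp.single_apply]

theorem scaledCoeff_ne_zero {n : ℕ} {f : MvPolynomial (Fin n) ℝ} {α : Fin n →₀ ℕ} :
    scaledCoeff f α ≠ 0 ↔ α ∈ f.support := by
  rw [MvPolynomial.mem_support_iff, scaledCoeff, mul_ne_zero_iff]
  simp [Finset.prod_ne_zero_iff, Nat.factorial_ne_zero]

/-- The exponent of the squarefree monomial of a set of variables. -/
noncomputable def indF {n : ℕ} (I : Finset (Fin n)) : Fin n →₀ ℕ :=
  Finsupp.equivFunOnFinite.symm (ind I)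

@[simp] theorem indF_apply {n : ℕ} (I : Finset (Fin n)) (i : Fin n) : indF I i = ind I i := rfl

theorem ind_injective {n : ℕ} {I J : Finset (Fin n)} (h : ∀ i, ind I i = ind J i) : I = J := by
  ext i
  have := h i
  unfold ind at this
  split_ifs at this <;> simp_all

/-- The exponent given by a column of the matrix of partial derivatives. -/
noncomputable def colExp {n d : ℕ} (J : Fin n → Fin d) : Fin n →₀ ℕ :=
  Finsupp.equivFunOnFinite.symm fun i => (J i : ℕ)

@[simp] theorem colExp_apply {n d : ℕ} (J : Fin n → Fin d) (i : Fin n) : colExp J i = J i := rfl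

theorem colExp_injective {n d : ℕ} : Function.Injective (colExp (n := n) (d := d)) := by
  intro J J' h
  funext i
  exact Fin.ext (DFunLike.congr_fun h i)

/-- No exponent is lost by the finite choice of columns: every entry of an exponent in the support
is at most the total degree. -/
theorem exists_colExp {n : ℕ} {f : MvPolynomial (Fin n) ℝ} {α P : Fin n →₀ ℕ} (hP : P ∈ f.support)
    (h : ∀ i, α i ≤ P i) : ∃ J : Fin n → Fin (f.totalDegree + 1), colExp J = α := by
  refine ⟨fun i => ⟨α i, Nat.lt_succ_of_le ((h i).trans ?_)⟩, by ext i; rfl⟩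
  refine le_trans ?_ (MvPolynomial.le_totalDegree hP)
  rw [Finsupp.sum_fintype _ _ (by simp)]
  exact Finset.single_le_sum (f := fun i => P i) (fun _ _ => Nat.zero_le _) (Finset.mem_univ i)

theorem derivMatrix_apply {n : ℕ} (f : MvPolynomial (Fin n) ℝ) (k : ℕ)
    (I : {I : Finset (Fin n) // I.card = k}) (J : Fin n → Fin (f.totalDegree + 1)) :
    derivMatrix f k I J = scaledCoeff f (colExp J + indF I.1) := by
  rw [derivMatrix, Matrix.of_apply, scaledCoeff_partialDeriv]
  rfl

/-! ### The proxy rank is at most the rank -/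

theorem isHermitian_gram {n : ℕ} (f : MvPolynomial (Fin n) ℝ) (k : ℕ) :
    (gram f k).IsHermitian := by
  rw [gram, ← Matrix.conjTranspose_eq_transpose_of_trivial]
  exact Matrix.isHermitian_conjTranspose_mul_self _

/-- Diagonalise A = U D U* with U unitary; then A² = U D² U*, and the trace is cyclic. -/
theorem trace_mul_self_eq_sum_eigenvalues {m : Type*} [Fintype m] [DecidableEq m]
    {A : Matrix m m ℝ} (hA : A.IsHermitian) : (A * A).trace = ∑ i, hA.eigenvalues i ^ 2 := by
  have h := hA.spectral_theorem
  rw [Unitary.conjStarAlgAut_apply] at h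
  set U : Matrix m m ℝ := (hA.eigenvectorUnitary : Matrix m m ℝ)
  set D : Matrix m m ℝ := Matrix.diagonal (RCLike.ofReal ∘ hA.eigenvalues)
  have hU : star U * U = 1 := Unitary.coe_star_mul_self _
  have h2 : A * A = U * (D * D * star U) := by
    calc A * A = (U * D * star U) * (U * D * star U) := by rw [← h]
      _ = U * (D * (star U * U) * D * star U) := by simp only [Matrix.mul_assoc]
      _ = _ := by rw [hU, Matrix.mul_one]
  rw [h2, Matrix.trace_mul_comm, Matrix.mul_assoc, hU, Matrix.mul_one]
  simp [D, Matrix.diagonal_mul_diagonal, Matrix.trace_diagonal, sq]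

/-- The proxy rank of a symmetric matrix is at most its rank. -/
theorem trace_sq_div_le_rank {m : Type*} [Fintype m] [DecidableEq m]
    {A : Matrix m m ℝ} (hA : A.IsHermitian) : A.trace ^ 2 / (A * A).trace ≤ A.rank := by
  have h2 := trace_mul_self_eq_sum_eigenvalues hA
  have h0 : 0 ≤ (A * A).trace := h2 ▸ Finset.sum_nonneg fun _ _ => sq_nonneg _
  -- This form also covers a vanishing denominator, where the quotient is 0.
  refine div_le_of_le_mul₀ h0 (Nat.cast_nonneg _) ?_
  rw [h2, hA.trace_eq_sum_eigenvalues, hA.rank_eq_card_non_zero_eigs, Fintype.card_subtype]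
  have h3 : ∑ i, (hA.eigenvalues i : ℝ) =
      ∑ i ∈ Finset.univ.filter (fun i => hA.eigenvalues i ≠ 0), hA.eigenvalues i :=
    (Finset.sum_filter_ne_zero _).symm
  have h4 : ∑ i ∈ Finset.univ.filter (fun i => hA.eigenvalues i ≠ 0), hA.eigenvalues i ^ 2 ≤
      ∑ i, hA.eigenvalues i ^ 2 :=
    Finset.sum_le_sum_of_subset_of_nonneg (Finset.subset_univ _) fun _ _ _ => sq_nonneg _
  -- Cauchy-Schwarz over the nonzero eigenvalues, whose number is the rank.
  calc (∑ i, ((hA.eigenvalues i : ℝ) : ℝ)) ^ 2 = _ := by rw [h3]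
    _ ≤ _ := sq_sum_le_card_mul_sum_sq
    _ ≤ _ := mul_le_mul_of_nonneg_left h4 (Nat.cast_nonneg _)

/-- Comparing values of `finrank` requires finite dimension. The exponents β of sum k have entries
at most k, so there are finitely many generators. -/
theorem finite_derivSpace {n : ℕ} (f : MvPolynomial (Fin n) ℝ) (k : ℕ) :
    Module.Finite ℝ (derivSpace f k) := by
  refine Module.Finite.span_of_finite ℝ ?_
  have h : {β : Fin n → ℕ | ∑ i, β i = k}.Finite := by
    refine (Set.Finite.pi' (t := fun _ : Fin n => Set.Iic k) fun _ => Set.finite_Iic k).subset ?_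
    intro β hβ i
    rw [Set.mem_Iic, ← show ∑ i, β i = k from hβ]
    exact Finset.single_le_sum (fun _ _ => Nat.zero_le _) (Finset.mem_univ i)
  refine (h.image fun β => partialDeriv β f).subset ?_
  rintro g ⟨β, hβ, rfl⟩
  exact ⟨β, hβ, rfl⟩

/-- Taking coordinates is linear and maps the generators ∂_I f to the rows, so the row space lies in
the image of the space of derivatives. -/
theorem rank_derivMatrix_le {n : ℕ} (f : MvPolynomial (Fin n) ℝ) (k : ℕ) :
    (derivMatrix f k).rank ≤ Module.finrank ℝ (derivSpace f k) := by
  let L : MvPolynomial (Fin n) ℝ →ₗ[ℝ] ((Fin n → Fin (f.totalDegree + 1)) → ℝ) :=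
    { toFun := fun g J => scaledCoeff g (colExp J)
      map_add' := fun g h => by funext J; simp [scaledCoeff, add_mul]
      map_smul' := fun c g => by funext J; simp [scaledCoeff, mul_assoc] }
  have := finite_derivSpace f k
  rw [Matrix.rank_eq_finrank_span_row]
  refine (Submodule.finrank_mono ?_).trans (Submodule.finrank_map_le L (derivSpace f k))
  rw [Submodule.span_le]
  rintro _ ⟨I, rfl⟩
  refine ⟨partialDeriv (ind I.1) f, Submodule.subset_span ⟨ind I.1, ?_, rfl⟩, rfl⟩
  simp [ind, I.2]

theorem proxyRank_le {n : ℕ} (f : MvPolynomial (Fin n) ℝ) (k : ℕ) :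
    proxyRank f k ≤ (Module.finrank ℝ (derivSpace f k) : ℝ) := by
  refine (trace_sq_div_le_rank (isHermitian_gram f k)).trans ?_
  rw [gram, Matrix.rank_transpose_mul_self]
  exact_mod_cast rank_derivMatrix_le f k

/-! ### The traces -/

theorem trace_gram_mul_gram {n : ℕ} (f : MvPolynomial (Fin n) ℝ) (k : ℕ) :
    (gram f k * gram f k).trace =
      ∑ x : (Fin n → Fin (f.totalDegree + 1)) × (Fin n → Fin (f.totalDegree + 1)) ×
          {I : Finset (Fin n) // I.card = k} × {I : Finset (Fin n) // I.card = k},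
        scaledCoeff f (colExp x.1 + indF x.2.2.1.1) * scaledCoeff f (colExp x.2.1 + indF x.2.2.1.1) *
          scaledCoeff f (colExp x.1 + indF x.2.2.2.1) *
          scaledCoeff f (colExp x.2.1 + indF x.2.2.2.1) := by
  simp only [Fintype.sum_prod_type, Matrix.trace, Matrix.diag, Matrix.mul_apply, gram,
    Matrix.transpose_apply, derivMatrix_apply, Finset.sum_mul_sum]
  refine Finset.sum_congr rfl fun a _ => Finset.sum_congr rfl fun b _ =>
    Finset.sum_congr rfl fun I _ => Finset.sum_congr rfl fun J _ => ?_
  ring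

/-- The trace of the square as a sum over the exponents of the polynomial. -/
theorem trace_gram_mul_gram_eq {n : ℕ} (f : MvPolynomial (Fin n) ℝ) (k : ℕ) :
    (gram f k * gram f k).trace =
      ∑ P ∈ f.support, ∑ Q ∈ f.support, ∑ R ∈ f.support,
        (rowCount f k P Q R : ℝ) * scaledCoeff f P * scaledCoeff f Q * scaledCoeff f R *
          scaledCoeff f (Q + R - P) := by
  classical
  have hR : ∑ P ∈ f.support, ∑ Q ∈ f.support, ∑ R ∈ f.support,
        (rowCount f k P Q R : ℝ) * scaledCoeff f P * scaledCoeff f Q * scaledCoeff f R *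
          scaledCoeff f (Q + R - P) =
      ∑ y ∈ (f.support ×ˢ f.support ×ˢ f.support ×ˢ (Finset.univ : Finset (Finset (Fin n)))).filter
        fun y => y.2.2.2 ∈ rowSet f k y.1 y.2.1 y.2.2.1,
        scaledCoeff f y.1 * scaledCoeff f y.2.1 * scaledCoeff f y.2.2.1 *
          scaledCoeff f (y.2.1 + y.2.2.1 - y.1) := by
    rw [Finset.sum_filter, Finset.sum_product]
    refine Finset.sum_congr rfl fun P _ => ?_
    rw [Finset.sum_product]
    refine Finset.sum_congr rfl fun Q _ => ?_
    rw [Finset.sum_product]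
    refine Finset.sum_congr rfl fun R _ => ?_
    dsimp only
    rw [← Finset.sum_filter, Finset.sum_const, rowCount, Set.ncard_eq_toFinset_card', nsmul_eq_mul]
    simp only [mul_assoc]
    congr 3
    ext I
    simp
  rw [hR, trace_gram_mul_gram, ← Finset.sum_filter_ne_zero]
  -- The bijection sends (a, b, I, J) to (a + I, b + I, a + J, I). For a nonzero term all four
  -- exponents lie in the support, and the fourth, b + J, is Q + R - P.
  refine Finset.sum_bij
    (fun x _ => (colExp x.1 + indF x.2.2.1.1, colExp x.2.1 + indF x.2.2.1.1,
      colExp x.1 + indF x.2.2.2.1, x.2.2.1.1)) ?_ ?_ ?_ ?_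
  · rintro ⟨a, b, ⟨I, hI⟩, ⟨J, hJ⟩⟩ hx
    simp only [Finset.mem_filter, Finset.mem_univ, true_and, mul_ne_zero_iff,
      scaledCoeff_ne_zero] at hx
    obtain ⟨⟨⟨hP, hQ⟩, hR⟩, hS⟩ := hx
    have hS' : colExp b + indF I + (colExp a + indF J) - (colExp a + indF I) =
        colExp b + indF J := by
      ext i; simp; omega
    rw [Finset.mem_filter]
    simp only [Finset.mem_product, Finset.mem_univ, and_true, hP, hQ, hR,
      rowSet, Set.mem_ofPred_eq, hS', hS, true_and]
    refine ⟨?_, hI, fun i => by simp, fun i => by simp, J, hJ, fun i => by simp⟩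
    intro i
    simp
    omega
  · rintro ⟨a, b, ⟨I, hI⟩, ⟨J, hJ⟩⟩ _ ⟨a', b', ⟨I', hI'⟩, ⟨J', hJ'⟩⟩ _ h
    simp only [Prod.mk.injEq] at h
    obtain ⟨h1, h2, h3, rfl⟩ := h
    obtain rfl := colExp_injective (add_right_cancel h1)
    obtain rfl := colExp_injective (add_right_cancel h2)
    obtain rfl := ind_injective fun i => DFunLike.congr_fun (add_left_cancel h3) i
    rfl
  · rintro ⟨P, Q, R, I⟩ hy
    rw [Finset.mem_filter] at hy
    simp only [Finset.mem_product, rowSet, Set.mem_ofPred_eq] at hy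
    obtain ⟨-, ⟨hP, hQ, hR, hle, hS⟩, hI, hIP, hIQ, J, hJ, hIJ⟩ := hy
    -- The columns are recovered as P - I and Q - I; the truncated subtraction is exact because I ≤
    -- P and I ≤ Q.
    obtain ⟨a, ha⟩ := exists_colExp (α := P - indF I) hP fun i => by simp
    obtain ⟨b, hb⟩ := exists_colExp (α := Q - indF I) hQ fun i => by simp
    have e1 : colExp a + indF I = P := by
      rw [ha]; ext i; have := hIP i; simp; omega
    have e2 : colExp b + indF I = Q := by
      rw [hb]; ext i; have := hIQ i; simp; omega
    have e3 : colExp a + indF J = R := by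
      rw [ha]; ext i; have := hIP i; have := hIJ i; simp; omega
    have e4 : colExp b + indF J = Q + R - P := by
      rw [hb]; ext i; have := hIP i; have := hIQ i; have := hIJ i; simp; omega
    refine ⟨(a, b, ⟨I, hI⟩, ⟨J, hJ⟩), ?_, ?_⟩
    · simp only [Finset.mem_filter, Finset.mem_univ, true_and, mul_ne_zero_iff,
        scaledCoeff_ne_zero, e1, e2, e3, e4]
      exact ⟨⟨⟨hP, hQ⟩, hR⟩, hS⟩
    · simp only [e1, e2, e3]
  · rintro ⟨a, b, I, J⟩ _
    have hS' : colExp b + indF I.1 + (colExp a + indF J.1) - (colExp a + indF I.1) =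
        colExp b + indF J.1 := by
      ext i; simp; omega
    simp only [hS']

/-- The trace as a sum over the exponents of the polynomial. -/
theorem trace_gram_eq {n : ℕ} (f : MvPolynomial (Fin n) ℝ) (k : ℕ) :
    (gram f k).trace = ∑ P ∈ f.support,
      ((Finset.univ.filter fun i => 0 < P i).card.choose k : ℝ) * scaledCoeff f P ^ 2 := by
  classical
  have hR : ∑ P ∈ f.support,
      ((Finset.univ.filter fun i => 0 < P i).card.choose k : ℝ) * scaledCoeff f P ^ 2 =
      ∑ y ∈ (f.support ×ˢ (Finset.univ : Finset (Finset (Fin n)))).filter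
        fun y => y.2 ∈ (Finset.univ.filter fun i => 0 < y.1 i).powersetCard k,
        scaledCoeff f y.1 ^ 2 := by
    rw [Finset.sum_filter, Finset.sum_product]
    refine Finset.sum_congr rfl fun P _ => ?_
    dsimp only
    rw [← Finset.sum_filter, Finset.sum_const, nsmul_eq_mul, ← Finset.card_powersetCard]
    congr 3
    ext I
    simp
  have hL : (gram f k).trace = ∑ x : (Fin n → Fin (f.totalDegree + 1)) ×
      {I : Finset (Fin n) // I.card = k}, scaledCoeff f (colExp x.1 + indF x.2.1) ^ 2 := by
    simp only [Fintype.sum_prod_type, Matrix.trace, Matrix.diag, Matrix.mul_apply, gram,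
      Matrix.transpose_apply, derivMatrix_apply, sq]
  rw [hR, hL, ← Finset.sum_filter_ne_zero]
  -- A column a and a row I with nonzero entry correspond to an exponent P = a + I with a k-element
  -- set I of variables that occur in P.
  refine Finset.sum_bij (fun x _ => (colExp x.1 + indF x.2.1, x.2.1)) ?_ ?_ ?_ ?_
  · rintro ⟨a, I, hI⟩ hx
    simp only [Finset.mem_filter, Finset.mem_univ, true_and, ne_eq, sq_eq_zero_iff] at hx
    rw [← ne_eq, scaledCoeff_ne_zero] at hx
    simp only [Finset.mem_filter, Finset.mem_product, hx, Finset.mem_univ, and_true, true_and,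
      Finset.mem_powersetCard, hI, Finset.subset_iff]
    intro i hi
    simp [ind, hi]
  · rintro ⟨a, I, hI⟩ _ ⟨a', I', hI'⟩ _ h
    simp only [Prod.mk.injEq] at h
    obtain ⟨h1, rfl⟩ := h
    obtain rfl := colExp_injective (add_right_cancel h1)
    rfl
  · rintro ⟨P, I⟩ hy
    simp only [Finset.mem_filter, Finset.mem_product, Finset.mem_univ, and_true,
      Finset.mem_powersetCard, Finset.subset_iff, true_and] at hy
    obtain ⟨hP, hIP, hI⟩ := hy
    obtain ⟨a, ha⟩ := exists_colExp (α := P - indF I) hP fun i => by simp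
    have e1 : colExp a + indF I = P := by
      rw [ha]; ext i
      by_cases hi : i ∈ I
      · have := hIP hi
        simp [ind, hi]; omega
      · simp [ind, hi]
    refine ⟨(a, ⟨I, hI⟩), ?_, ?_⟩
    · simp only [Finset.mem_filter, Finset.mem_univ, true_and, e1]
      exact pow_ne_zero 2 (scaledCoeff_ne_zero.2 hP)
    · simp only [e1]
  · rintro ⟨a, I⟩ _
    rfl

/-! ### The multiplicities -/

/-- From P - R = I - J it follows that I \ J and J \ I are the positions of 1 and -1, while I ∩ J
lies in the zero positions where P and Q are positive. Conversely, any K of the right size among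
these positions yields I and J by adding the positions of 1 and of -1, respectively. -/
theorem mem_rowSet_iff {n : ℕ} {P Q R : Fin n →₀ ℕ} {k : ℕ} {I : Finset (Fin n)} :
    (I.card = k ∧ (∀ i, ind I i ≤ P i) ∧ (∀ i, ind I i ≤ Q i) ∧
      ∃ J : Finset (Fin n), J.card = k ∧
        ∀ i, (P i : ℤ) - (ind I i : ℤ) = (R i : ℤ) - (ind J i : ℤ)) ↔
    (∀ i, P i ≤ R i + 1 ∧ R i ≤ P i + 1) ∧ (onesSet P R).card = (onesSet R P).card ∧
      (∀ i ∈ onesSet P R, 0 < min (P i) (Q i)) ∧ (onesSet P R).card ≤ k ∧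
      ∃ K ∈ (zerosSet P Q R).powersetCard (k - (onesSet P R).card), onesSet P R ∪ K = I := by
  classical
  have hdis : Disjoint (onesSet P R) (zerosSet P Q R) := by
    rw [Finset.disjoint_left]
    intro i hi hi'
    simp only [onesSet, zerosSet, Finset.mem_filter] at hi hi'
    omega
  constructor
  · rintro ⟨hI, hP, hQ, J, hJ, hIJ⟩
    have hO : onesSet P R = I \ J := by
      ext i
      have := hIJ i
      by_cases h1 : i ∈ I <;> by_cases h2 : i ∈ J <;> simp [onesSet, ind, h1, h2] at * <;> omega
    have hO' : onesSet R P = J \ I := by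
      ext i
      have := hIJ i
      by_cases h1 : i ∈ I <;> by_cases h2 : i ∈ J <;> simp [onesSet, ind, h1, h2] at * <;> omega
    refine ⟨fun i => ?_, ?_, fun i hi => ?_, ?_, I ∩ J, ?_, ?_⟩
    · have := hIJ i
      unfold ind at this
      split_ifs at this <;> omega
    · rw [hO, hO']
      have h1 := Finset.card_sdiff_add_card_inter I J
      have h2 := Finset.card_sdiff_add_card_inter J I
      rw [Finset.inter_comm] at h2
      omega
    · rw [hO, Finset.mem_sdiff] at hi
      have h1 := hP i
      have h2 := hQ i
      simp [ind, hi.1] at h1 h2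
      omega
    · rw [hO, ← hI]
      exact Finset.card_le_card Finset.sdiff_subset
    · rw [Finset.mem_powersetCard]
      constructor
      · intro i hi
        rw [Finset.mem_inter] at hi
        have h0 := hIJ i
        have h1 := hP i
        have h2 := hQ i
        simp [ind, hi.1, hi.2] at h0 h1 h2
        simp [zerosSet]
        omega
      · rw [hO]
        have h1 := Finset.card_sdiff_add_card_inter I J
        omega
    · rw [hO, Finset.sdiff_union_inter]
  · rintro ⟨h1, h2, h3, h4, K, hK, rfl⟩
    rw [Finset.mem_powersetCard] at hK
    have hd : Disjoint (onesSet P R) K := hdis.mono_right hK.1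
    have hd' : Disjoint (onesSet R P) K := by
      rw [Finset.disjoint_left]
      intro i hi hi'
      have := hK.1 hi'
      simp only [onesSet, zerosSet, Finset.mem_filter] at hi this
      omega
    have hpos : ∀ i ∈ onesSet P R ∪ K, 0 < min (P i) (Q i) := by
      intro i hi
      rcases Finset.mem_union.1 hi with hi | hi
      · exact h3 i hi
      · have := hK.1 hi
        simp only [zerosSet, Finset.mem_filter] at this
        exact this.2.2
    refine ⟨?_, fun i => ?_, fun i => ?_, onesSet R P ∪ K, ?_, fun i => ?_⟩
    · rw [Finset.card_union_of_disjoint hd, hK.2]; omega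
    · unfold ind
      split_ifs with hi
      · have := hpos i hi; omega
      · omega
    · unfold ind
      split_ifs with hi
      · have := hpos i hi; omega
      · omega
    · rw [Finset.card_union_of_disjoint hd', hK.2]; omega
    · have h5 := h1 i
      by_cases hi : i ∈ K
      · have := hK.1 hi
        simp only [zerosSet, Finset.mem_filter] at this
        simp [ind, hi, this.2.1]
      · simp [ind, hi, onesSet]
        split_ifs <;> omega

/-- The sets counted are the unions of the positions of 1 with the sets K; as these are disjoint, K
is recovered by removing the former. -/
theorem rowCount_eq {n : ℕ} (f : MvPolynomial (Fin n) ℝ) (k : ℕ) {P Q R : Fin n →₀ ℕ}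
    (hP : P ∈ f.support) (hQ : Q ∈ f.support) (hR : R ∈ f.support) :
    rowCount f k P Q R = binomCount f k P Q R := by
  classical
  have hdis : Disjoint (onesSet P R) (zerosSet P Q R) := by
    rw [Finset.disjoint_left]
    intro i hi hi'
    simp only [onesSet, zerosSet, Finset.mem_filter] at hi hi'
    omega
  rw [rowCount, binomCount]
  simp only [rowSet, mem_rowSet_iff, hP, hQ, hR, true_and]
  split_ifs with h
  · obtain ⟨h0, h1, h2, h3, h4⟩ := h
    have : {I | (P ≤ Q + R ∧ Q + R - P ∈ f.support) ∧
        (∀ i, P i ≤ R i + 1 ∧ R i ≤ P i + 1) ∧ (onesSet P R).card = (onesSet R P).card ∧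
        (∀ i ∈ onesSet P R, 0 < min (P i) (Q i)) ∧ (onesSet P R).card ≤ k ∧
        ∃ K ∈ (zerosSet P Q R).powersetCard (k - (onesSet P R).card), onesSet P R ∪ K = I} =
        ((fun K => onesSet P R ∪ K) ''
          ((zerosSet P Q R).powersetCard (k - (onesSet P R).card) : Set (Finset (Fin n)))) := by
      ext I
      exact ⟨fun h => h.2.2.2.2.2, fun h => ⟨h0, h1, h2, h3, h4, h⟩⟩
    rw [this, Set.InjOn.ncard_image, Set.ncard_coe_finset, Finset.card_powersetCard]
    intro K hK K' hK' he
    simp only [Finset.mem_coe, Finset.mem_powersetCard] at hK hK'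
    rw [← Finset.union_sdiff_cancel_left (hdis.mono_right hK.1),
      ← Finset.union_sdiff_cancel_left (hdis.mono_right hK'.1)]
    exact congrArg (· \ onesSet P R) he
  · rw [Set.ncard_eq_zero]
    ext I
    simp only [Set.mem_ofPred_eq, Set.mem_empty_iff_false, iff_false]
    rintro ⟨h0, h1, h2, h3, h4, -⟩
    exact h ⟨h0, h1, h2, h3, h4⟩

end ProxyRank

namespace ProxyRank

open Turing Computability
open ProxyRank.TreeRep (rep)

variable {γ : Type} [TreeRep γ]

/-! ### The algorithm -/

/-- The product of `s - i` over the numbers `i < k` of the list `r`. -/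
def desc (r : List ℕ) (s k : ℕ) : ℕ := (r.map fun i => bif decide (i < k) then s - i else 1).prod

/-- The product of `i + 1` over the numbers `i < k` of the list `r`. -/
def fact (r : List ℕ) (k : ℕ) : ℕ := (r.map fun i => bif decide (i < k) then i + 1 else 1).prod

/-- A count: the number of members of a list that satisfy a condition. -/
def cnt {α : Type} (l : List α) (p : α → Bool) : ℕ :=
  (l.map fun a => bif p a then 1 else 0).sum

/-- Do all members of a list satisfy a condition? -/
def every {α : Type} (l : List α) (p : α → Bool) : ℕ :=
  (l.map fun a => bif p a then 1 else 0).prod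

theorem PT.desc {r : γ → List ℕ} {s k : γ → ℕ} (hr : PT r) (hs : PT s) (hk : PT k) :
    PT fun x => desc (r x) (s x) (k x) :=
  PT.prod hr (PT.cond (PT.lt PT.snd' (hk.comp PT.fst')) (PT.sub (hs.comp PT.fst') PT.snd')
    (PT.const 1))

theorem PT.fact {r : γ → List ℕ} {k : γ → ℕ} (hr : PT r) (hk : PT k) :
    PT fun x => fact (r x) (k x) :=
  PT.prod hr (PT.cond (PT.lt PT.snd' (hk.comp PT.fst')) (PT.add PT.snd' (PT.const 1))
    (PT.const 1))

theorem PT.cnt {α : Type} [TreeRep α] {l : γ → List α} {p : γ → α → Bool}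
    (hl : PT l) (hp : PT fun x : γ × α => p x.1 x.2) :
    PT fun x => cnt (l x) (p x) :=
  PT.sum hl (PT.cond hp (PT.const 1) (PT.const 0))

theorem PT.every {α : Type} [TreeRep α] {l : γ → List α} {p : γ → α → Bool}
    (hl : PT l) (hp : PT fun x : γ × α => p x.1 x.2) :
    PT fun x => every (l x) (p x) :=
  PT.prod hl (PT.cond hp (PT.const 1) (PT.const 0))

/-- A monomial: the sign and the absolute value of an integer coefficient, and the exponents. -/
abbrev Mono := (Bool × ℕ) × List ℕ

/-- The multiplicity of a quadruple of exponent vectors, times `k! ^ 2`; here `c` is the list of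
the quadruples of exponents. -/
def weight (r : List ℕ) (k : ℕ) (c : List (ℕ × ℕ × ℕ × ℕ)) : ℕ :=
  bif decide (cnt c (fun e => decide (e.1 = e.2.2.1 + 1)) =
      cnt c (fun e => decide (e.2.2.1 = e.1 + 1))) &&
      decide (cnt c (fun e => decide (e.1 = e.2.2.1 + 1)) ≤ k) then
    every c (fun e => decide (e.1 + e.2.2.2 = e.2.1 + e.2.2.1) &&
      (decide (e.1 = e.2.2.1) || ((decide (e.1 = e.2.2.1 + 1) && decide (0 < e.2.1)) ||
        decide (e.2.2.1 = e.1 + 1)))) *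
    (desc r (cnt c fun e => decide (e.1 = e.2.2.1) && (decide (0 < e.1) && decide (0 < e.2.1)))
      (k - cnt c fun e => decide (e.1 = e.2.2.1 + 1)) *
      (desc r k (cnt c fun e => decide (e.1 = e.2.2.1 + 1)) * fact r k))
  else 0

theorem PT.weight {r : γ → List ℕ} {k : γ → ℕ} {c : γ → List (ℕ × ℕ × ℕ × ℕ)} (hr : PT r)
    (hk : PT k) (hc : PT c) : PT fun x => weight (r x) (k x) (c x) := by
  have hp : PT fun x : γ × ℕ × ℕ × ℕ × ℕ => x.2.1 := PT.snd'.fst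
  have hq : PT fun x : γ × ℕ × ℕ × ℕ × ℕ => x.2.2.1 := PT.snd'.snd.fst
  have hr' : PT fun x : γ × ℕ × ℕ × ℕ × ℕ => x.2.2.2.1 := PT.snd'.snd.snd.fst
  have hs : PT fun x : γ × ℕ × ℕ × ℕ × ℕ => x.2.2.2.2 := PT.snd'.snd.snd.snd
  have h0 (m : ℕ) : PT fun x : γ × ℕ × ℕ × ℕ × ℕ => m := PT.const m
  have ho : PT fun x => ProxyRank.cnt (c x) fun e => decide (e.1 = e.2.2.1 + 1) :=
    PT.cnt (p := fun _ e => decide (e.1 = e.2.2.1 + 1)) hc (hp.eq (hr'.add (h0 1)))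
  have ho' : PT fun x => ProxyRank.cnt (c x) fun e => decide (e.2.2.1 = e.1 + 1) :=
    PT.cnt (p := fun _ e => decide (e.2.2.1 = e.1 + 1)) hc (hr'.eq (hp.add (h0 1)))
  have hz : PT fun x => ProxyRank.cnt (c x) fun e => decide (e.1 = e.2.2.1) && (decide (0 < e.1) && decide (0 < e.2.1)) :=
    PT.cnt (p := fun _ e => decide (e.1 = e.2.2.1) && (decide (0 < e.1) && decide (0 < e.2.1))) hc
      ((hp.eq hr').and (((h0 0).lt hp).and ((h0 0).lt hq)))
  have he : PT fun x => ProxyRank.every (c x) fun e => decide (e.1 + e.2.2.2 = e.2.1 + e.2.2.1) &&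
      (decide (e.1 = e.2.2.1) || ((decide (e.1 = e.2.2.1 + 1) && decide (0 < e.2.1)) ||
        decide (e.2.2.1 = e.1 + 1))) :=
    PT.every (p := fun _ e => decide (e.1 + e.2.2.2 = e.2.1 + e.2.2.1) &&
      (decide (e.1 = e.2.2.1) || ((decide (e.1 = e.2.2.1 + 1) && decide (0 < e.2.1)) ||
        decide (e.2.2.1 = e.1 + 1)))) hc
      (((hp.add hs).eq (hq.add hr')).and ((hp.eq hr').or
        (((hp.eq (hr'.add (h0 1))).and ((h0 0).lt hq)).or (hr'.eq (hp.add (h0 1))))))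
  exact PT.cond ((ho.eq ho').and (ho.le hk))
    (he.mul ((PT.desc hr hz (hk.sub ho)).mul ((PT.desc hr hk ho).mul (PT.fact hr hk))))
    (PT.const 0)

/-- The list of the quadruples of exponents of four monomials. -/
def quads (P Q R S : Mono) : List (ℕ × ℕ × ℕ × ℕ) := P.2.zip (Q.2.zip (R.2.zip S.2))

/-- The contribution of four monomials to the positive (for `b = false`) or the negative (for
`b = true`) terms of the trace of the square. -/
def quadTerm (b : Bool) (r : List ℕ) (k : ℕ) (P Q R S : Mono) : ℕ :=
  bif xor b (xor (xor P.1.1 Q.1.1) (xor R.1.1 S.1.1)) then 0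
  else weight r k (quads P Q R S) * (P.1.2 * Q.1.2 * R.1.2 * S.1.2)

/-- The positive or the negative terms of the trace of the square, times `k! ^ 2`. -/
def traceSq (b : Bool) (r : List ℕ) (k : ℕ) (L : List Mono) : ℕ :=
  (L.map fun P => (L.map fun Q => (L.map fun R => (L.map fun S =>
    quadTerm b r k P Q R S).sum).sum).sum).sum

/-- The trace, times `k!`. -/
def traceOne (r : List ℕ) (k : ℕ) (L : List Mono) : ℕ :=
  (L.map fun P => desc r (cnt P.2 fun e => decide (0 < e)) k * (P.1.2 * P.1.2)).sum

theorem PT.quads {P Q R S : γ → Mono} (hP : PT P) (hQ : PT Q) (hR : PT R) (hS : PT S) :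
    PT fun x => quads (P x) (Q x) (R x) (S x) :=
  hP.snd.zip (hQ.snd.zip (hR.snd.zip hS.snd))

theorem PT.quadTerm {b : Bool} {r : γ → List ℕ} {k : γ → ℕ} {P Q R S : γ → Mono} (hr : PT r)
    (hk : PT k) (hP : PT P) (hQ : PT Q) (hR : PT R) (hS : PT S) :
    PT fun x => quadTerm b (r x) (k x) (P x) (Q x) (R x) (S x) :=
  PT.cond ((PT.const b).bxor ((hP.fst.fst.bxor hQ.fst.fst).bxor (hR.fst.fst.bxor hS.fst.fst)))
    (PT.const 0) ((PT.weight hr hk (PT.quads hP hQ hR hS)).mul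
      (((hP.fst.snd.mul hQ.fst.snd).mul hR.fst.snd).mul hS.fst.snd))

theorem PT.traceSq {b : Bool} {r : γ → List ℕ} {k : γ → ℕ} {L : γ → List Mono} (hr : PT r)
    (hk : PT k) (hL : PT L) : PT fun x => traceSq b (r x) (k x) (L x) := by
  have h1 : PT fun x : γ × Mono => x.1 := PT.fst'
  have h2 : PT fun x : (γ × Mono) × Mono => x.1.1 := PT.fst'.fst
  have h3 : PT fun x : ((γ × Mono) × Mono) × Mono => x.1.1.1 := PT.fst'.fst.fst
  have h4 : PT fun x : (((γ × Mono) × Mono) × Mono) × Mono => x.1.1.1.1 := PT.fst'.fst.fst.fst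
  exact PT.sum hL (PT.sum (hL.comp h1) (PT.sum (hL.comp h2) (PT.sum (hL.comp h3)
    (PT.quadTerm (hr.comp h4) (hk.comp h4) PT.fst'.fst.fst.snd PT.fst'.fst.snd PT.fst'.snd
      PT.snd'))))

theorem PT.traceOne {r : γ → List ℕ} {k : γ → ℕ} {L : γ → List Mono} (hr : PT r)
    (hk : PT k) (hL : PT L) : PT fun x => traceOne (r x) (k x) (L x) := by
  have h1 : PT fun x : γ × Mono => x.1 := PT.fst'
  exact PT.sum hL ((PT.desc (hr.comp h1) (PT.cnt (p := fun _ e => decide (0 < e)) PT.snd'.snd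
    (PT.lt (PT.const 0) PT.snd')) (hk.comp h1)).mul (PT.snd'.fst.snd.mul PT.snd'.fst.snd))

/-- The monomial with integer coefficient that results from a monomial, given by its coefficient, a
fraction, and its exponents, if the polynomial with the monomials `l` is multiplied by the product
of the denominators of its coefficients. -/
def clearDenom (l : List ((Bool × ℕ × ℕ) × List ℕ)) (t : (Bool × ℕ × ℕ) × List ℕ) : Mono :=
  ((t.1.1, t.1.2.1 *
    (l.map fun s => bif decide (every (s.2.zip t.2) (fun e => decide (e.1 = e.2)) = 1) then 1
      else s.1.2.2).prod), t.2)

theorem PT.clearDenom {l : γ → List ((Bool × ℕ × ℕ) × List ℕ)}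
    {t : γ → (Bool × ℕ × ℕ) × List ℕ} (hl : PT l) (ht : PT t) :
    PT fun x => clearDenom (l x) (t x) := by
  have h1 : PT fun x : γ × ((Bool × ℕ × ℕ) × List ℕ) =>
      ProxyRank.every (x.2.2.zip (t x.1).2) fun e => decide (e.1 = e.2) :=
    PT.every (p := fun _ e => decide (e.1 = e.2)) (PT.snd'.snd.zip (ht.comp PT.fst').snd)
      (PT.snd'.fst.eq PT.snd'.snd)
  exact (ht.fst.fst.pair (ht.fst.snd.fst.mul (PT.prod hl (PT.cond (h1.eq (PT.const 1)) (PT.const 1)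
    PT.snd'.fst.snd.snd)))).pair ht.snd

/-- The numerator and the denominator of the proxy rank. -/
def proxyFrac (r : List ℕ) (k : ℕ) (L : List Mono) : ℕ × ℕ :=
  bif decide (traceOne r k L = 0) then (0, 1)
  else (traceOne r k L * traceOne r k L, traceSq false r k L - traceSq true r k L)

theorem PT.proxyFrac {r : γ → List ℕ} {k : γ → ℕ} {L : γ → List Mono} (hr : PT r)
    (hk : PT k) (hL : PT L) : PT fun x => proxyFrac (r x) (k x) (L x) := by
  have h := PT.traceOne hr hk hL
  exact PT.cond (h.eq (PT.const 0)) (PT.const (0, 1))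
    ((h.mul h).pair ((PT.traceSq hr hk hL).sub (PT.traceSq hr hk hL)))

/-! ### Reading the input and writing the output -/

/-- One step of reading an input word from right to left. The state consists of the fields (words
of bits that are ended by commas) of the current monomial, and of the list of the monomials. -/
def parseStep (s : List (List Bool) × List (List (List Bool))) :
    Sym → List (List Bool) × List (List (List Bool))
  | .bit b => ((b :: s.1.headD []) :: s.1.tail, s.2)
  | .comma => ([] :: s.1, s.2)
  | .bra => ([], s.1 :: s.2)
  | _ => s

/-- The fields in front of the first monomial, and the list of the fields of the monomials. -/
def parse (w : List Sym) : List (List Bool) × List (List (List Bool)) :=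
  w.reverse.foldl parseStep ([], [])

/-- The code of a symbol. -/
def symCode : Sym → Bool × Bool × Bool
  | .bit b => (true, (b, true))
  | .comma => (false, (true, true))
  | .bra => (false, (true, false))
  | _ => (false, (false, false))

theorem PT.symCode {s : γ → Sym} (hs : PT s) : PT fun x => symCode (s x) :=
  hs.congr_rep fun x => by
    generalize s x = y
    rcases y with _ | ⟨_ | _⟩ | _ | _ | _ <;> rfl

theorem parseStep_eq (s : List (List Bool) × List (List (List Bool))) (y : Sym) :
    parseStep s y = bif (symCode y).1 then (((symCode y).2.1 :: s.1.headD []) :: s.1.tail, s.2)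
      else bif (symCode y).2.1 then bif (symCode y).2.2 then ([] :: s.1, s.2) else ([], s.1 :: s.2)
      else s := by
  rcases y with _ | ⟨_ | _⟩ | _ | _ | _ <;> rfl

theorem PT.parse {w : γ → List Sym} (hw : PT w) : PT fun x => parse (w x) := by
  have hs : PT fun x : γ × (List (List Bool) × List (List (List Bool))) × Sym => x.2.1 := PT.snd'.fst
  have hy : PT fun x : γ × (List (List Bool) × List (List (List Bool))) × Sym =>
    ProxyRank.symCode x.2.2 := PT.symCode PT.snd'.snd
  -- A symbol adds at most 6 to the size; the extreme case is a bit `true` that has to open a new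
  -- field.
  refine PT.foldl_add (g := fun _ => parseStep) hw.reverse (PT.const ([], [])) ?_ 6
    fun x s y _ => ?_
  · simp only [parseStep_eq]
    exact hy.fst.cond ((PT.cons (PT.cons hy.snd.fst (hs.fst.headD (PT.const []))) hs.fst.tail).pair
      hs.snd) (hy.snd.fst.cond (hy.snd.snd.cond ((PT.cons (PT.const []) hs.fst).pair hs.snd)
      ((PT.const []).pair (PT.cons hs.fst hs.snd))) hs)
  · obtain ⟨_ | ⟨f, fs⟩, ts⟩ := s
    · rcases y with _ | ⟨_ | _⟩ | _ | _ | _ <;> simp [parseStep, sz_bool] <;> omega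
    · rcases y with _ | ⟨_ | _⟩ | _ | _ | _ <;> simp [parseStep, sz_bool] <;> omega

/-- The monomial with the given fields, if `e` reads the exponents and the coefficient has to be
multiplied by `m`. -/
def readTerm (e : List Bool → ℕ) (m : List (List Bool) → ℕ) (F : List (List Bool)) :
    (Bool × ℕ × ℕ) × List ℕ :=
  (((F.headD []).headD false, (ofBits (F.headD []).tail.reverse * m F.tail.tail,
    ofBits (F.tail.headD []).reverse)), F.tail.tail.map e)

/-- The numerator and the denominator of the proxy rank, computed from the result of parsing. -/
def proxyParsed (e : List Bool → ℕ) (m : List (List Bool) → ℕ)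
    (p : List (List Bool) × List (List (List Bool))) : ℕ × ℕ :=
  proxyFrac (List.range (true :: p.1.headD []).length) (ofBits (p.1.tail.headD []).reverse)
    ((p.2.map (readTerm e m)).map (clearDenom (p.2.map (readTerm e m))))

/-- The output for a given numerator and denominator. -/
def outFrac (q : ℕ × ℕ) : List (Option Bool) :=
  some false :: (q.1.bits.map some ++ (none :: (q.2.bits.map some ++ [none])))

theorem PT.readTerm {e : List Bool → ℕ} {m : List (List Bool) → ℕ} (he : PT e) (hm : PT m)
    {F : γ → List (List Bool)} (hF : PT F) : PT fun x => ProxyRank.readTerm e m (F x) :=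
  (((hF.headD (PT.const [])).headD (PT.const false)).pair
    (((hF.headD (PT.const [])).tail.reverse.ofBits.mul (hm.comp hF.tail.tail)).pair
      (hF.tail.headD (PT.const [])).reverse.ofBits)).pair
    (PT.map (g := fun _ => e) hF.tail.tail (he.comp PT.snd'))

theorem PT.proxyParsed {e : List Bool → ℕ} {m : List (List Bool) → ℕ} (he : PT e) (hm : PT m) :
    PT (ProxyRank.proxyParsed e m) := by
  have hl : PT fun p : List (List Bool) × List (List (List Bool)) => p.2.map (ProxyRank.readTerm e m) :=
    PT.map (g := fun _ => ProxyRank.readTerm e m) PT.snd' (PT.readTerm he hm PT.snd')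
  exact PT.proxyFrac (PT.range (PT.cons (PT.const true) (PT.fst'.headD (PT.const []))))
    (PT.fst'.tail.headD (PT.const [])).reverse.ofBits
    (PT.map hl (PT.clearDenom (hl.comp PT.fst') PT.snd'))

theorem PT.outFrac {q : γ → ℕ × ℕ} (hq : PT q) : PT fun x => outFrac (q x) := by
  have hs {δ : Type} [TreeRep δ] : PT fun x : δ × Bool => some x.2 := by
    convert PT.cond PT.snd' (PT.const (some true)) (PT.const (some false)) using 2 with x
    cases x.2 <;> rfl
  exact PT.cons (PT.const (some false)) ((PT.map (g := fun _ => some) hq.fst.bits hs).append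
    (PT.cons (PT.const none) ((PT.map (g := fun _ => some) hq.snd.bits hs).append
      (PT.const [none]))))

/-- The algorithm. -/
theorem PT.algorithm {e : List Bool → ℕ} {m : List (List Bool) → ℕ} (he : PT e) (hm : PT m) :
    PT fun w => ProxyRank.outFrac (ProxyRank.proxyParsed e m (ProxyRank.parse w)) :=
  PT.outFrac ((PT.proxyParsed he hm).comp (PT.parse PT.id))

/-- Reading a binary number. -/
theorem PT.readBin : PT fun l : List Bool => ProxyRank.ofBits l.reverse := (PT.reverse PT.id).ofBits

/-- The length of a word, counted. -/
theorem PT.length {α : Type} [TreeRep α] : PT fun l : List α => l.length := by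
  convert PT.sum (g := fun _ _ => 1) PT.id (PT.const 1) using 2 with l
  simp

/-- The product of the factorials of numbers in unary. -/
theorem PT.prodFactorial :
    PT fun F : List (List Bool) => (F.map fun l => ((List.range l.length).map (· + 1)).prod).prod :=
  PT.prod (g := fun _ (l : List Bool) => ((List.range l.length).map (· + 1)).prod) PT.id
    (PT.prod (g := fun _ i => i + 1) (PT.range PT.snd') (PT.snd'.add (PT.const 1)))

end ProxyRank

namespace ProxyRank

open Turing Computability

/-! ### Correctness of the formulas -/

theorem prod_map_range (N : ℕ) (g : ℕ → ℕ) :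
    ((List.range N).map g).prod = ∏ i ∈ Finset.range N, g i := by
  induction N with
  | zero => rfl
  | succ N ih => simp [List.range_succ, Finset.prod_range_succ, ih]

theorem prod_range_cond {N k : ℕ} (h : k ≤ N) (g : ℕ → ℕ) :
    ((List.range N).map fun i => bif decide (i < k) then g i else 1).prod =
      ∏ i ∈ Finset.range k, g i := by
  rw [prod_map_range]
  simp only [Bool.cond_decide]
  rw [← Finset.prod_filter]
  congr 1
  ext i
  simp
  omega

/-- For k ≤ N all factors of the falling factorial are present. For k > N > s the factor with i = s
makes both sides zero. Thus N rounds suffice, however large k is. -/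
theorem desc_range {N s k : ℕ} (h : k ≤ N ∨ s < N) : desc (List.range N) s k = s.descFactorial k := by
  by_cases hk : k ≤ N
  · rw [desc, prod_range_cond hk, Nat.descFactorial_eq_prod_range]
  · have hs : s < N := h.resolve_left hk
    rw [Nat.descFactorial_of_lt (by omega), desc, List.prod_eq_zero_iff, List.mem_map]
    exact ⟨s, by simpa using hs, by simp [show s < k by omega]⟩

theorem fact_range {N k : ℕ} (h : k ≤ N) : fact (List.range N) k = k ! := by
  rw [fact, prod_range_cond h, Finset.prod_range_add_one_eq_factorial]

theorem cnt_ofFn {n : ℕ} {α : Type} (v : Fin n → α) (p : α → Bool) :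
    cnt (List.ofFn v) p = (Finset.univ.filter fun i => p (v i) = true).card := by
  rw [cnt, List.map_ofFn, List.sum_ofFn, Finset.card_filter]
  exact Finset.sum_congr rfl fun i _ => by cases h : p (v i) <;> simp [h]

theorem every_ofFn {n : ℕ} {α : Type} (v : Fin n → α) (p : α → Bool) :
    every (List.ofFn v) p = if ∀ i, p (v i) = true then 1 else 0 := by
  rw [every, List.map_ofFn, List.prod_ofFn]
  split_ifs with h
  · exact Finset.prod_eq_one fun i _ => by simp [h i]
  · push Not at h
    obtain ⟨i, hi⟩ := h
    exact Finset.prod_eq_zero (Finset.mem_univ i) (by simp [hi])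

theorem zip_ofFn {n : ℕ} {α β : Type} (v : Fin n → α) (w : Fin n → β) :
    (List.ofFn v).zip (List.ofFn w) = List.ofFn fun i => (v i, w i) := by
  rw [List.ofFn_eq_map, List.ofFn_eq_map, List.ofFn_eq_map, List.zip_map']

/-- A monomial in the form used by the algorithm. -/
def toMono {n : ℕ} (t : (Fin n →₀ ℕ) × (Bool × ℕ)) : Mono := (t.2, List.ofFn fun i => t.1 i)

theorem quads_toMono {n : ℕ} (P Q R S : (Fin n →₀ ℕ) × (Bool × ℕ)) :
    quads (toMono P) (toMono Q) (toMono R) (toMono S) =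
      List.ofFn fun i => (P.1 i, Q.1 i, R.1 i, S.1 i) := by
  simp only [quads, toMono, zip_ofFn]

/-- With o ones and z zeros, the falling factorials are (k - o)! C(z, k - o) and k! / (k - o)!.
Their product with the further factor k! is k!² C(z, k - o), obtained without division. -/
theorem weight_ofFn {n k : ℕ} (hk : k ≤ n) (P Q R S : Fin n →₀ ℕ) :
    weight (List.range (n + 1)) k (List.ofFn fun i => (P i, Q i, R i, S i)) =
      if P + S = Q + R ∧ (∀ i, P i ≤ R i + 1 ∧ R i ≤ P i + 1) ∧
        (onesSet P R).card = (onesSet R P).card ∧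
        (∀ i ∈ onesSet P R, 0 < min (P i) (Q i)) ∧ (onesSet P R).card ≤ k
      then k ! ^ 2 * (zerosSet P Q R).card.choose (k - (onesSet P R).card) else 0 := by
  have ho : cnt (List.ofFn fun i => (P i, Q i, R i, S i)) (fun e => decide (e.1 = e.2.2.1 + 1)) =
      (onesSet P R).card := by
    simp only [cnt_ofFn, onesSet, decide_eq_true_eq]
  have ho' : cnt (List.ofFn fun i => (P i, Q i, R i, S i)) (fun e => decide (e.2.2.1 = e.1 + 1)) =
      (onesSet R P).card := by
    simp only [cnt_ofFn, onesSet, decide_eq_true_eq]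
  have hz : cnt (List.ofFn fun i => (P i, Q i, R i, S i))
      (fun e => decide (e.1 = e.2.2.1) && (decide (0 < e.1) && decide (0 < e.2.1))) =
      (zerosSet P Q R).card := by
    simp only [cnt_ofFn, zerosSet, Bool.and_eq_true, decide_eq_true_eq, lt_min_iff]
  have hcard (A : Finset (Fin n)) : A.card ≤ n := by simpa using Finset.card_le_univ A
  rw [weight, ho, ho', hz, every_ofFn, desc_range (Or.inr (Nat.lt_succ_of_le (hcard _))),
    desc_range (Or.inl ((hcard _).trans (Nat.le_succ _))), fact_range (by omega)]
  simp only [Bool.and_eq_true, Bool.or_eq_true, decide_eq_true_eq]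
  have hcond : (∀ i, P i + S i = Q i + R i ∧ (P i = R i ∨ (P i = R i + 1 ∧ 0 < Q i) ∨
      R i = P i + 1)) ↔ P + S = Q + R ∧ (∀ i, P i ≤ R i + 1 ∧ R i ≤ P i + 1) ∧
        (∀ i ∈ onesSet P R, 0 < min (P i) (Q i)) := by
    simp only [onesSet, Finset.mem_filter, Finset.mem_univ, true_and, Finsupp.ext_iff,
      Finsupp.add_apply, lt_min_iff]
    constructor
    · intro h
      refine ⟨fun i => (h i).1, fun i => ?_, fun i hi => ?_⟩
      · have := (h i).2; omega
      · have := (h i).2; omega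
    · rintro ⟨h1, h2, h3⟩ i
      refine ⟨h1 i, ?_⟩
      have := h2 i
      have := h3 i
      omega
  by_cases h1 : (onesSet P R).card = (onesSet R P).card ∧ (onesSet P R).card ≤ k
  · by_cases h2 : ∀ i, P i + S i = Q i + R i ∧ (P i = R i ∨ (P i = R i + 1 ∧ 0 < Q i) ∨
      R i = P i + 1)
    · have h3 := hcond.1 h2
      rw [if_pos h2, if_pos ⟨h3.1, h3.2.1, h1.1, h3.2.2, h1.2⟩,
        Nat.descFactorial_eq_factorial_mul_choose, ← Nat.factorial_mul_descFactorial h1.2]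
      simp only [h1.1] at *
      simp [h1.2]
      ring
    · rw [if_neg h2, if_neg fun h => h2 (hcond.2 ⟨h.1, h.2.1, h.2.2.2.1⟩)]
      simp
  · have : (decide ((onesSet P R).card = (onesSet R P).card) && decide ((onesSet P R).card ≤ k)) =
        false := by
      rw [← Bool.decide_and]; exact decide_eq_false h1
    rw [this, cond_false, if_neg fun h => h1 ⟨h.2.2.1, h.2.2.2.2⟩]

/-- The integer with the given sign and absolute value. -/
def sgnVal (q : Bool × ℕ) : ℝ := (bif q.1 then -1 else 1) * q.2

theorem sgnVal_sq (q : Bool × ℕ) : sgnVal q ^ 2 = (q.2 : ℝ) * q.2 := by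
  obtain ⟨_ | _, m⟩ := q <;> simp [sgnVal] <;> ring

/-- The exclusive or of the four signs is the sign of the product; each quadruple of monomials is
thus counted in just one of the two sums. -/
theorem quadTerm_sub (r : List ℕ) (k : ℕ) (P Q R S : Mono) :
    (quadTerm false r k P Q R S : ℝ) - quadTerm true r k P Q R S =
      weight r k (quads P Q R S) * (sgnVal P.1 * sgnVal Q.1 * sgnVal R.1 * sgnVal S.1) := by
  obtain ⟨⟨p, p'⟩, P⟩ := P
  obtain ⟨⟨q, q'⟩, Q⟩ := Q
  obtain ⟨⟨r, r'⟩, R⟩ := R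
  obtain ⟨⟨s, s'⟩, S⟩ := S
  cases p <;> cases q <;> cases r <;> cases s <;> simp [quadTerm, sgnVal]

section

variable {n : ℕ} {f : MvPolynomial (Fin n) ℝ} {k : ℕ} {L : List ((Fin n →₀ ℕ) × (Bool × ℕ))}
  {c : ℝ}

theorem sum_map_eq (hnd : (L.map Prod.fst).Nodup) (hs : f.support = (L.map Prod.fst).toFinset)
    (F : (Fin n →₀ ℕ) × (Bool × ℕ) → ℝ) (G : (Fin n →₀ ℕ) → ℝ) (h : ∀ t ∈ L, F t = G t.1) :
    (L.map F).sum = ∑ P ∈ f.support, G P := by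
  rw [hs, List.sum_toFinset _ hnd, List.map_map]
  exact congrArg List.sum (List.map_congr_left h)

/-- The algorithm uses integers in place of the coordinates of `f`, which are c times these
integers; the trace is quadratic in them, and its square-matrix analogue in `traceSq_spec` is
quartic. -/
theorem traceOne_spec (hnd : (L.map Prod.fst).Nodup)
    (hs : f.support = (L.map Prod.fst).toFinset)
    (hA : ∀ t ∈ L, scaledCoeff f t.1 = c * sgnVal t.2) :
    c ^ 2 * traceOne (List.range (n + 1)) k (L.map toMono) = k ! * (gram f k).trace := by
  rw [trace_gram_eq, Finset.mul_sum, traceOne, List.map_map, Nat.cast_list_sum, List.map_map,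
    ← List.sum_map_mul_left]
  refine sum_map_eq hnd hs _ _ fun t ht => ?_
  have hcard (A : Finset (Fin n)) : A.card ≤ n := by simpa using Finset.card_le_univ A
  simp only [Function.comp, toMono, cnt_ofFn, decide_eq_true_eq]
  rw [desc_range (Or.inr (Nat.lt_succ_of_le (hcard _))),
    Nat.descFactorial_eq_factorial_mul_choose, hA t ht, mul_pow, sgnVal_sq]
  push_cast
  ring

/-- Instead of searching for the coefficient at Q + R - P, the algorithm lets S run over all
monomials; the condition P + S = Q + R in the weight leaves at most this one term. -/
theorem sum_weight_mul (hk : k ≤ n) (P Q R : Fin n →₀ ℕ) :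
    ∑ S ∈ f.support, (weight (List.range (n + 1)) k (List.ofFn fun i => (P i, Q i, R i, S i)) : ℝ) *
        scaledCoeff f S = (k ! ^ 2 * binomCount f k P Q R) * scaledCoeff f (Q + R - P) := by
  classical
  simp only [weight_ofFn hk]
  by_cases h0 : P ≤ Q + R ∧ Q + R - P ∈ f.support
  · rw [Finset.sum_eq_single_of_mem _ h0.2]
    · have : P + (Q + R - P) = Q + R := add_tsub_cancel_of_le h0.1
      simp only [this, true_and, binomCount, h0, and_self]
      congr 1
      split_ifs <;> simp
    · intro S _ hS
      rw [if_neg, Nat.cast_zero, zero_mul]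
      rintro ⟨h, -⟩
      exact hS (by rw [← h, add_tsub_cancel_left])
  · rw [binomCount, if_neg fun h => h0 h.1, Nat.cast_zero, mul_zero, zero_mul]
    refine Finset.sum_eq_zero fun S hS => ?_
    rw [if_neg, Nat.cast_zero, zero_mul]
    rintro ⟨h, -⟩
    exact h0 ⟨h ▸ le_self_add, by rwa [← h, add_tsub_cancel_left]⟩

theorem sum_map_sub {ι : Type*} (l : List ι) (f g : ι → ℝ) :
    (l.map f).sum - (l.map g).sum = (l.map fun a => f a - g a).sum := by
  induction l with
  | nil => simp
  | cons a l ih => simp only [List.map_cons, List.sum_cons, ← ih]; ring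

theorem traceSq_spec (hnd : (L.map Prod.fst).Nodup)
    (hs : f.support = (L.map Prod.fst).toFinset)
    (hA : ∀ t ∈ L, scaledCoeff f t.1 = c * sgnVal t.2) (hk : k ≤ n) :
    c ^ 4 * ((traceSq false (List.range (n + 1)) k (L.map toMono) : ℝ) -
      traceSq true (List.range (n + 1)) k (L.map toMono)) =
        k ! ^ 2 * (gram f k * gram f k).trace := by
  have h1 : (traceSq false (List.range (n + 1)) k (L.map toMono) : ℝ) -
      traceSq true (List.range (n + 1)) k (L.map toMono) =
      (L.map fun P => (L.map fun Q => (L.map fun R => (L.map fun S =>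
        (quadTerm false (List.range (n + 1)) k (toMono P) (toMono Q) (toMono R) (toMono S) : ℝ) -
        quadTerm true (List.range (n + 1)) k (toMono P) (toMono Q) (toMono R)
          (toMono S)).sum).sum).sum).sum := by
    simp only [traceSq, Nat.cast_list_sum, List.map_map, Function.comp_def, sum_map_sub]
  rw [h1, trace_gram_mul_gram_eq, Finset.mul_sum, ← List.sum_map_mul_left]
  refine sum_map_eq hnd hs _ _ fun P hP => ?_
  rw [Finset.mul_sum, ← List.sum_map_mul_left]
  refine sum_map_eq hnd hs _ _ fun Q hQ => ?_
  rw [Finset.mul_sum, ← List.sum_map_mul_left]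
  refine sum_map_eq hnd hs _ _ fun R hR => ?_
  have hmem {t : (Fin n →₀ ℕ) × (Bool × ℕ)} (ht : t ∈ L) : t.1 ∈ f.support := by
    rw [hs, List.mem_toFinset]
    exact List.mem_map_of_mem ht
  rw [← List.sum_map_mul_left, rowCount_eq f k (hmem hP) (hmem hQ) (hmem hR)]
  have h2 := sum_weight_mul (f := f) hk P.1 Q.1 R.1
  calc _ = scaledCoeff f P.1 * scaledCoeff f Q.1 * scaledCoeff f R.1 *
        ∑ S ∈ f.support, (weight (List.range (n + 1)) k
          (List.ofFn fun i => (P.1 i, Q.1 i, R.1 i, S i)) : ℝ) * scaledCoeff f S := by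
        rw [Finset.mul_sum]
        refine sum_map_eq hnd hs _ _ fun S hS => ?_
        rw [quadTerm_sub, quads_toMono, hA P hP, hA Q hQ, hA R hR, hA S hS]
        simp only [toMono]
        ring
    _ = _ := by rw [h2]; ring

/-- A vanishing sum of squares makes all eigenvalues zero. Hence a nonzero trace guarantees a
positive denominator. -/
theorem trace_gram_eq_zero (h : (gram f k * gram f k).trace = 0) : (gram f k).trace = 0 := by
  have hA := isHermitian_gram f k
  rw [trace_mul_self_eq_sum_eigenvalues hA,
    Finset.sum_eq_zero_iff_of_nonneg fun _ _ => sq_nonneg _] at h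
  rw [hA.trace_eq_sum_eigenvalues]
  exact Finset.sum_eq_zero fun i hi => by simpa using h i hi

theorem trace_gram_mul_gram_nonneg (f : MvPolynomial (Fin n) ℝ) (k : ℕ) :
    0 ≤ (gram f k * gram f k).trace := by
  rw [trace_mul_self_eq_sum_eigenvalues (isHermitian_gram f k)]
  exact Finset.sum_nonneg fun _ _ => sq_nonneg _

/-- The formula of the algorithm yields the proxy rank. -/
theorem proxyFrac_spec (hnd : (L.map Prod.fst).Nodup)
    (hs : f.support = (L.map Prod.fst).toFinset) (hc : 0 < c)
    (hA : ∀ t ∈ L, scaledCoeff f t.1 = c * sgnVal t.2) :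
    0 < (proxyFrac (List.range (n + 1)) k (L.map toMono)).2 ∧
    ((proxyFrac (List.range (n + 1)) k (L.map toMono)).1 : ℝ) /
      (proxyFrac (List.range (n + 1)) k (L.map toMono)).2 = proxyRank f k := by
  have h1 := traceOne_spec (k := k) hnd hs hA
  have hk0 : (k ! : ℝ) ≠ 0 := by exact_mod_cast Nat.factorial_ne_zero k
  rw [proxyFrac, Bool.cond_decide]
  set T := traceOne (List.range (n + 1)) k (L.map toMono)
  split_ifs with hT
  -- A zero trace makes the proxy rank 0, in agreement with the output 0/1.
  · have : (gram f k).trace = 0 := by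
      rw [hT, Nat.cast_zero, mul_zero, zero_eq_mul] at h1
      exact h1.resolve_left hk0
    simp [proxyRank, this]
  · have hT' : (gram f k).trace ≠ 0 := by
      intro h
      rw [h, mul_zero, mul_eq_zero] at h1
      rcases h1 with h1 | h1
      · exact (pow_pos hc 2).ne' h1
      · exact hT (by exact_mod_cast h1)
    -- For k > n there are no k-element sets of variables, and the trace would be zero.
    have hk : k ≤ n := by
      by_contra hk
      refine hT' ?_
      rw [trace_gram_eq]
      refine Finset.sum_eq_zero fun P _ => ?_
      have hcard : (Finset.univ.filter fun i => 0 < P i).card ≤ n := by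
        simpa using Finset.card_le_univ (Finset.univ.filter fun i => 0 < P i)
      rw [Nat.choose_eq_zero_of_lt (by omega), Nat.cast_zero, zero_mul]
    have h2 := traceSq_spec hnd hs hA hk
    set U := traceSq false (List.range (n + 1)) k (L.map toMono)
    set V := traceSq true (List.range (n + 1)) k (L.map toMono)
    have hB : 0 < (gram f k * gram f k).trace :=
      lt_of_le_of_ne (trace_gram_mul_gram_nonneg f k) fun h => hT' (trace_gram_eq_zero h.symm)
    have hUV : 0 < (U : ℝ) - V := by
      refine pos_of_mul_pos_right ?_ (pow_pos hc 4).le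
      rw [h2]
      positivity
    have hVU : V < U := by exact_mod_cast sub_pos.1 hUV
    refine ⟨by simpa using hVU, ?_⟩
    rw [proxyRank, Nat.cast_sub hVU.le]
    rw [div_eq_div_iff hUV.ne' hB.ne']
    have hcc : c ^ 4 * (k ! : ℝ) ^ 2 ≠ 0 := by positivity
    -- After cross-multiplication, the factor c⁴ k!² is just what turns T² into the square of c² T
    -- and U - V into c⁴ (U - V), so that `h1` and `h2` apply.
    refine mul_left_cancel₀ hcc ?_
    push_cast
    calc _ = (c ^ 2 * (T : ℝ)) ^ 2 * ((k ! : ℝ) ^ 2 * (gram f k * gram f k).trace) := by ring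
      _ = (k ! * (gram f k).trace) ^ 2 * (c ^ 4 * ((U : ℝ) - V)) := by rw [h1, h2]
      _ = _ := by ring

end

/-! ### Correctness of reading and writing -/

theorem encodeNat_eq_bits (m : ℕ) : encodeNat m = m.bits := by
  have h (p : PosNum) : encodePosNum p = (p : ℕ).bits := by
    induction p with
    | one => simp [encodePosNum]
    | bit0 p ih =>
      rw [encodePosNum, ih, PosNum.cast_bit0, ← two_mul, Nat.bit0_bits _ (PosNum.cast_pos p).ne']
    | bit1 p ih =>
      rw [encodePosNum, ih, PosNum.cast_bit1, ← two_mul, Nat.bit1_bits]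
  rw [encodeNat]
  conv_rhs => rw [← Num.to_of_nat m]
  rcases (m : Num) with _ | p
  · simp [encodeNum]
  · rw [encodeNum, h]
    simp

theorem ofBits_reverse_encodeNat (m : ℕ) : ofBits (encodeNat m).reverse = m := by
  rw [encodeNat_eq_bits, ofBits_reverse_bits]

theorem outFrac_spec (q : ℕ × ℕ) (h : 0 < q.2) :
    (outFrac q).map outSym = encFrac ((q.1 : ℤ), (⟨q.2, h⟩ : ℕ+)) := by
  have hn : ¬ ((q.1 : ℤ) < 0) := by omega
  simp [outFrac, encFrac, encBin, encodeNat_eq_bits, outSym, Function.comp_def, hn]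

/-- Reading a word from right to left. -/
def parseFrom (w : List Sym) (s : List (List Bool) × List (List (List Bool))) :
    List (List Bool) × List (List (List Bool)) :=
  w.foldr (fun y s => parseStep s y) s

theorem parse_eq (w : List Sym) : parse w = parseFrom w ([], []) := by
  rw [parse, List.foldl_reverse, parseFrom]

theorem parseFrom_append (u v : List Sym) (s : List (List Bool) × List (List (List Bool))) :
    parseFrom (u ++ v) s = parseFrom u (parseFrom v s) := List.foldr_append ..

/-- Read from the right, the comma comes first and opens an empty field, to which the bits are then
prepended. -/
theorem parseFrom_bits (u : List Bool) (F : List (List Bool)) (T : List (List (List Bool))) :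
    parseFrom (u.map Γ'.bit ++ [Γ'.comma]) (F, T) = (u :: F, T) := by
  induction u with
  | nil => rfl
  | cons b u ih =>
    rw [parseFrom] at ih
    simp only [parseFrom, List.map_cons, List.cons_append, List.foldr_cons, ih]
    rfl

theorem parseFrom_frac (q : Frac) (F : List (List Bool)) (T : List (List (List Bool))) :
    parseFrom (encFrac q) (F, T) =
      ((decide (q.1 < 0) :: encodeNat q.1.natAbs) :: encodeNat (q.2 : ℕ) :: F, T) := by
  have h : parseFrom (encBin q.1.natAbs ++ encBin (q.2 : ℕ)) (F, T) =
      (encodeNat q.1.natAbs :: encodeNat (q.2 : ℕ) :: F, T) := by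
    rw [parseFrom_append, encBin, encBin, parseFrom_bits, parseFrom_bits]
  rw [encFrac, parseFrom, List.foldr_cons]
  rw [parseFrom] at h
  rw [h]
  rfl

theorem parseFrom_flatMap {e : ℕ → List Sym} {eb : ℕ → List Bool}
    (he : ∀ m, e m = (eb m).map Γ'.bit ++ [Γ'.comma]) (l : List ℕ) (F : List (List Bool))
    (T : List (List (List Bool))) : parseFrom (l.flatMap e) (F, T) = (l.map eb ++ F, T) := by
  induction l with
  | nil => rfl
  | cons a l ih => rw [List.flatMap_cons, parseFrom_append, ih, he, parseFrom_bits]; rfl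

/-- The fields of a monomial. -/
def fields (eb : ℕ → List Bool) {n : ℕ} (t : (Fin n →₀ ℕ) × Frac) : List (List Bool) :=
  (decide (t.2.1 < 0) :: encodeNat t.2.1.natAbs) :: encodeNat (t.2.2 : ℕ) ::
    (List.ofFn fun i => t.1 i).map eb

/-- The opening bracket is read last; it files the fields of its monomial and empties the first
component, so that the next monomial meets the same initial state. -/
theorem parseFrom_terms {e : ℕ → List Sym} {eb : ℕ → List Bool}
    (he : ∀ m, e m = (eb m).map Γ'.bit ++ [Γ'.comma]) {n : ℕ} (l : List ((Fin n →₀ ℕ) × Frac)) :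
    parseFrom (l.flatMap (encTerm e)) ([], []) = ([], l.map (fields eb)) := by
  induction l with
  | nil => rfl
  | cons t l ih =>
    have h : parseFrom (encFrac t.2 ++ ((List.ofFn fun i => t.1 i).flatMap e ++ [Γ'.ket]))
        ([], l.map (fields eb)) = (fields eb t, l.map (fields eb)) := by
      rw [parseFrom_append, parseFrom_append]
      have : parseFrom [Γ'.ket] ([], l.map (fields eb)) = ([], l.map (fields eb)) := rfl
      rw [this, parseFrom_flatMap he, parseFrom_frac, List.append_nil]
      rfl
    rw [List.flatMap_cons, parseFrom_append, ih, encTerm]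
    rw [parseFrom] at h
    rw [parseFrom, List.foldr_cons, h]
    rfl

theorem parse_encInput {e : ℕ → List Sym} {eb : ℕ → List Bool}
    (he : ∀ m, e m = (eb m).map Γ'.bit ++ [Γ'.comma]) (x : Input) :
    parse (encInput e x) =
      ([List.replicate x.n true, encodeNat x.k], x.poly.terms.map (fields eb)) := by
  rw [parse_eq, encInput, parseFrom_append, parseFrom_append, parseFrom_terms he, encBin,
    parseFrom_bits, encUn, ← List.map_replicate, parseFrom_bits]

/-! ### Sparse polynomials -/

theorem coeff_sum_monomial {n : ℕ} {l : List ((Fin n →₀ ℕ) × Frac)}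
    (hl : (l.map Prod.fst).Nodup) (v : (Fin n →₀ ℕ) × Frac → ℝ) {t : (Fin n →₀ ℕ) × Frac}
    (ht : t ∈ l) :
    (l.map fun t => MvPolynomial.monomial t.1 (v t)).sum.coeff t.1 = v t := by
  induction l with
  | nil => simp at ht
  | cons s l ih =>
    rw [List.map_cons, List.nodup_cons] at hl
    rw [List.map_cons, List.sum_cons, MvPolynomial.coeff_add, MvPolynomial.coeff_monomial]
    rcases List.mem_cons.1 ht with rfl | ht
    · have h0 : ∀ m : List ((Fin n →₀ ℕ) × Frac), t.1 ∉ m.map Prod.fst →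
          (m.map fun t => MvPolynomial.monomial t.1 (v t)).sum.coeff t.1 = 0 := by
        intro m hm
        induction m with
        | nil => simp
        | cons s m ihm =>
          simp only [List.map_cons, List.mem_cons, not_or] at hm
          rw [List.map_cons, List.sum_cons, MvPolynomial.coeff_add, MvPolynomial.coeff_monomial,
            if_neg fun h => hm.1 h.symm, ihm hm.2, add_zero]
      rw [if_pos rfl, h0 l hl.1, add_zero]
    · rw [if_neg, ih hl.2 ht, zero_add]
      intro h
      exact hl.1 (h ▸ List.mem_map_of_mem ht)

theorem support_sum_monomial {n : ℕ} {l : List ((Fin n →₀ ℕ) × Frac)}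
    (hl : (l.map Prod.fst).Nodup) (v : (Fin n →₀ ℕ) × Frac → ℝ) (hv : ∀ t ∈ l, v t ≠ 0) :
    (l.map fun t => MvPolynomial.monomial t.1 (v t)).sum.support = (l.map Prod.fst).toFinset := by
  ext α
  rw [List.mem_toFinset]
  constructor
  · intro h
    by_contra hα
    rw [MvPolynomial.mem_support_iff] at h
    refine h ?_
    clear hl hv h
    induction l with
    | nil => simp
    | cons s m ihm =>
      simp only [List.map_cons, List.mem_cons, not_or] at hα
      rw [List.map_cons, List.sum_cons, MvPolynomial.coeff_add, MvPolynomial.coeff_monomial,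
        if_neg fun h => hα.1 h.symm, ihm hα.2, add_zero]
  · intro h
    obtain ⟨t, ht, rfl⟩ := List.mem_map.1 h
    rw [MvPolynomial.mem_support_iff, coeff_sum_monomial hl v ht]
    exact hv t ht

/-! ### Correctness of the algorithm -/

/-- Over the common denominator, the numerator of a term is multiplied by the denominators of all
other terms. The term itself is recognised by its exponent, which occurs only once. -/
theorem prod_cond_mul {n : ℕ} {l : List ((Fin n →₀ ℕ) × Frac)} (hl : (l.map Prod.fst).Nodup)
    {t : (Fin n →₀ ℕ) × Frac} (ht : t ∈ l) :
    (l.map fun s => if s.1 = t.1 then 1 else (s.2.2 : ℕ)).prod * (t.2.2 : ℕ) =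
      (l.map fun s => (s.2.2 : ℕ)).prod := by
  induction l with
  | nil => simp at ht
  | cons s l ih =>
    rw [List.map_cons, List.nodup_cons] at hl
    rw [List.map_cons, List.map_cons, List.prod_cons, List.prod_cons]
    rcases List.mem_cons.1 ht with rfl | ht
    · rw [if_pos rfl, one_mul, mul_comm]
      congr 2
      refine List.map_congr_left fun s hs => ?_
      rw [if_neg]
      intro h
      exact hl.1 (h ▸ List.mem_map_of_mem hs)
    · rw [if_neg, mul_assoc, ih hl.2 ht]
      intro h
      exact hl.1 (h ▸ List.mem_map_of_mem ht)

section

variable {e : ℕ → List Sym} {eb : ℕ → List Bool} {de : List Bool → ℕ}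
  {m : List (List Bool) → ℕ}

theorem readTerm_fields (hde : ∀ i, de (eb i) = i) {n : ℕ} (t : (Fin n →₀ ℕ) × Frac) :
    readTerm de m (fields eb t) = ((decide (t.2.1 < 0), t.2.1.natAbs *
      m ((List.ofFn fun i => t.1 i).map eb), (t.2.2 : ℕ)), List.ofFn fun i => t.1 i) := by
  simp [readTerm, fields, ofBits_reverse_encodeNat, Function.comp_def, hde]

theorem every_zip_eq {n : ℕ} (α β : Fin n →₀ ℕ) :
    decide (every ((List.ofFn fun i => α i).zip (List.ofFn fun i => β i))
      (fun e => decide (e.1 = e.2)) = 1) = decide (α = β) := by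
  rw [zip_ofFn, every_ofFn, decide_eq_decide, Finsupp.ext_iff]
  simp

/-- The monomials with integer coefficients which the algorithm computes. -/
def clearTerms {n : ℕ} (v : (Fin n →₀ ℕ) → ℕ) (l : List ((Fin n →₀ ℕ) × Frac)) :
    List ((Fin n →₀ ℕ) × (Bool × ℕ)) :=
  l.map fun t => (t.1, (decide (t.2.1 < 0), t.2.1.natAbs * v t.1 *
    (l.map fun s => if s.1 = t.1 then 1 else (s.2.2 : ℕ)).prod))

theorem proxyParsed_encInput (he : ∀ i, e i = (eb i).map Γ'.bit ++ [Γ'.comma])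
    (hde : ∀ i, de (eb i) = i) (x : Input) (v : (Fin x.n →₀ ℕ) → ℕ)
    (hm : ∀ α : Fin x.n →₀ ℕ, m ((List.ofFn fun i => α i).map eb) = v α) :
    proxyParsed de m (parse (encInput e x)) = proxyFrac (List.range (x.n + 1)) x.k
      ((clearTerms v x.poly.terms).map toMono) := by
  rw [parse_encInput he, proxyParsed]
  have h1 : (x.poly.terms.map (fields eb)).map (readTerm de m) = x.poly.terms.map fun t =>
      ((decide (t.2.1 < 0), t.2.1.natAbs * v t.1, (t.2.2 : ℕ)), List.ofFn fun i => t.1 i) := by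
    rw [List.map_map]
    refine List.map_congr_left fun t _ => ?_
    rw [Function.comp, readTerm_fields hde, hm]
  have h2 (t : (Fin x.n →₀ ℕ) × Frac) :
      clearDenom (x.poly.terms.map fun t => ((decide (t.2.1 < 0), t.2.1.natAbs * v t.1,
        (t.2.2 : ℕ)), List.ofFn fun i => t.1 i)) ((decide (t.2.1 < 0), t.2.1.natAbs * v t.1,
        (t.2.2 : ℕ)), List.ofFn fun i => t.1 i) =
      toMono (t.1, (decide (t.2.1 < 0), t.2.1.natAbs * v t.1 *
        (x.poly.terms.map fun s => if s.1 = t.1 then 1 else (s.2.2 : ℕ)).prod)) := by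
    simp only [clearDenom, toMono, List.map_map, Function.comp_def, every_zip_eq]
    simp only [Bool.cond_decide]
  dsimp only
  rw [h1, List.map_map, clearTerms, List.map_map]
  simp only [Function.comp_def, h2]
  simp [ofBits_reverse_encodeNat]

/-- Both input formats are handled at once: `eb` and `de` write and read the exponents, and `v` is
the factor that converts a listed coefficient into a coordinate in the scaled basis. -/
theorem algorithm_spec (hde : PT de) (hm : PT m)
    (he : ∀ i, e i = (eb i).map Γ'.bit ++ [Γ'.comma]) (hdeb : ∀ i, de (eb i) = i)
    (v : ∀ n, (Fin n →₀ ℕ) → ℕ) (hv : ∀ n α, v n α ≠ 0)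
    (hmv : ∀ n (α : Fin n →₀ ℕ), m ((List.ofFn fun i => α i).map eb) = v n α)
    (F : ∀ n, SparsePoly n → MvPolynomial (Fin n) ℝ)
    (hF : ∀ n (s : SparsePoly n), F n s = (s.terms.map fun t => MvPolynomial.monomial t.1
      (fracVal t.2 * v n t.1 / ∏ i, ((t.1 i)! : ℝ))).sum) :
    ∃ g : Input → Frac, PolyTime (encInput e) encFrac g ∧
      ∀ x : Input, fracVal (g x) = proxyRank (F x.n x.poly) x.k := by
  have hspec (x : Input) := by
    have hne : ∀ t ∈ x.poly.terms, fracVal t.2 * v x.n t.1 / ∏ i, ((t.1 i)! : ℝ) ≠ 0 := by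
      intro t ht
      have h1 : (t.2.1 : ℝ) ≠ 0 := by exact_mod_cast x.poly.ne_zero t ht
      have h2 : ((t.2.2 : ℕ) : ℝ) ≠ 0 := by exact_mod_cast t.2.2.ne_zero
      have h3 : (v x.n t.1 : ℝ) ≠ 0 := by exact_mod_cast hv x.n t.1
      have h4 : ∏ i, ((t.1 i)! : ℝ) ≠ 0 :=
        Finset.prod_ne_zero_iff.2 fun i _ => by exact_mod_cast Nat.factorial_ne_zero _
      exact div_ne_zero (mul_ne_zero (div_ne_zero h1 h2) h3) h4
    have hfst : (clearTerms (v x.n) x.poly.terms).map Prod.fst = x.poly.terms.map Prod.fst := by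
      rw [clearTerms, List.map_map]
      rfl
    have hD : 0 < (((x.poly.terms.map fun s => (s.2.2 : ℕ)).prod : ℕ) : ℝ) := by
      have : 0 < (x.poly.terms.map fun s => (s.2.2 : ℕ)).prod :=
        List.prod_pos fun a ha => by
          obtain ⟨s, -, rfl⟩ := List.mem_map.1 ha
          exact s.2.2.pos
      exact_mod_cast this
    have h := proxyFrac_spec (f := F x.n x.poly) (k := x.k)
      (L := clearTerms (v x.n) x.poly.terms)
      -- The integer coefficients are the coordinates times the product of all denominators, whose
      -- inverse is therefore the factor c.
      (c := 1 / (((x.poly.terms.map fun s => (s.2.2 : ℕ)).prod : ℕ) : ℝ))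
      (by rw [hfst]; exact x.poly.nodup)
      (by rw [hfst, hF]; exact support_sum_monomial x.poly.nodup _ hne) (one_div_pos.2 hD)
      (by
        intro s hs
        obtain ⟨t, ht, rfl⟩ := List.mem_map.1 hs
        have h4 : ∏ i, ((t.1 i)! : ℝ) ≠ 0 :=
          Finset.prod_ne_zero_iff.2 fun i _ => by exact_mod_cast Nat.factorial_ne_zero _
        have h2 : ((t.2.2 : ℕ) : ℝ) ≠ 0 := by exact_mod_cast t.2.2.ne_zero
        dsimp only
        rw [scaledCoeff, hF, coeff_sum_monomial x.poly.nodup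
          (fun t => fracVal t.2 * v x.n t.1 / ∏ i, ((t.1 i)! : ℝ)) ht, div_mul_cancel₀ _ h4,
          ← prod_cond_mul x.poly.nodup ht]
        have h5 : (((x.poly.terms.map fun s => if s.1 = t.1 then 1 else (s.2.2 : ℕ)).prod :
            ℕ) : ℝ) ≠ 0 := by
          intro h
          rw [← prod_cond_mul x.poly.nodup ht] at hD
          have : (x.poly.terms.map fun s => if s.1 = t.1 then 1 else (s.2.2 : ℕ)).prod = 0 := by
            exact_mod_cast h
          rw [this] at hD
          simp at hD
        have h6 : (bif decide (t.2.1 < 0) then -1 else 1) * (t.2.1.natAbs : ℝ) = t.2.1 := by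
          rw [Bool.cond_decide]
          split_ifs with h
          · rw [Nat.cast_natAbs, abs_of_neg h]; push_cast; ring
          · rw [Nat.cast_natAbs, abs_of_nonneg (not_lt.1 h), one_mul]
        rw [sgnVal, fracVal]
        dsimp only
        rw [← h6]
        rw [Nat.cast_mul, Nat.cast_mul, Nat.cast_mul]
        field_simp)
    rwa [← proxyParsed_encInput he hdeb x (v x.n) (hmv x.n)] at h
  refine ⟨fun x => (((proxyParsed de m (parse (encInput e x))).1 : ℤ),
    ⟨(proxyParsed de m (parse (encInput e x))).2, (hspec x).1⟩), ?_, fun x => ?_⟩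
  · exact (PT.algorithm hde hm).polyTime fun x => outFrac_spec _ (hspec x).1
  · rw [← (hspec x).2, fracVal]
    simp

end

end ProxyRank

/-! ### The main theorem -/

theorem mainTheorem6 :
    -- the proxy rank is a lower bound on the dimension of the space of partial derivatives
    (∀ (n : ℕ) (f : MvPolynomial (Fin n) ℝ) (k : ℕ),
      proxyRank f k ≤ (Module.finrank ℝ (derivSpace f k) : ℝ)) ∧
    -- the formula for the trace of the square
    (∀ (n : ℕ) (f : MvPolynomial (Fin n) ℝ) (k : ℕ),
      (gram f k * gram f k).trace =
        ∑ P ∈ f.support, ∑ Q ∈ f.support, ∑ R ∈ f.support,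
          (rowCount f k P Q R : ℝ) * scaledCoeff f P * scaledCoeff f Q * scaledCoeff f R *
            scaledCoeff f (Q + R - P)) ∧
    -- the multiplicities are explicit binomial coefficients
    (∀ (n : ℕ) (f : MvPolynomial (Fin n) ℝ) (k : ℕ),
      ∀ P ∈ f.support, ∀ Q ∈ f.support, ∀ R ∈ f.support,
        rowCount f k P Q R = binomCount f k P Q R) ∧
    -- polynomial time: coefficients in the scaled monomial basis, exponents in binary
    (∃ g : Input → Frac, PolyTime (encInput encBin) encFrac g ∧
      ∀ x : Input, fracVal (g x) = proxyRank x.poly.scaledPoly x.k) ∧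
    -- polynomial time: coefficients in the usual monomial basis, exponents in unary
    (∃ g : Input → Frac, PolyTime (encInput encUn) encFrac g ∧
      ∀ x : Input, fracVal (g x) = proxyRank x.poly.usualPoly x.k) := by
  refine ⟨fun n f k => proxyRank_le f k, fun n f k => trace_gram_mul_gram_eq f k,
    fun n f k P hP Q hQ R hR => rowCount_eq f k hP hQ hR, ?_, ?_⟩
  -- The listed coefficients already are the scaled coordinates. Exponents are only added and
  -- compared, so binary notation is affordable.
  · refine algorithm_spec (m := fun _ => 1) PT.readBin (PT.const 1) (eb := Computability.encodeNat)
      (fun i => rfl) ofBits_reverse_encodeNat (fun _ _ => 1) (fun _ _ => one_ne_zero)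
      (fun _ _ => rfl) (fun _ => SparsePoly.scaledPoly) fun n s => ?_
    simp [SparsePoly.scaledPoly]
  -- Passing to the scaled basis multiplies a coefficient by the factorials of its exponents; these
  -- have polynomially many bits because the exponents are in unary.
  · refine algorithm_spec PT.length PT.prodFactorial (eb := fun i => List.replicate i true)
      (fun i => by simp [encUn]) (fun i => by simp) (fun _ α => ∏ i, (α i)!)
      (fun _ _ => Finset.prod_ne_zero_iff.2 fun i _ => Nat.factorial_ne_zero _)
      (fun n α => ?_) (fun _ => SparsePoly.usualPoly) fun n s => ?_
    · simp only [List.map_ofFn, List.prod_ofFn, Function.comp_def,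
        List.length_replicate, prod_map_range, Finset.prod_range_add_one_eq_factorial]
    · rw [SparsePoly.usualPoly]
      congr 1
      refine List.map_congr_left fun t _ => ?_
      have h4 : ∏ i, ((t.1 i)! : ℝ) ≠ 0 :=
        Finset.prod_ne_zero_iff.2 fun i _ => by exact_mod_cast Nat.factorial_ne_zero _
      congr 1
      push_cast
      rw [mul_div_cancel_right₀ _ h4]
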